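/- Let $m,n\ge 2$, let $S_n(1)$ be the probability simplex in $\mathbb R^n$, $p_1,\dots,p_m\in S_n(1)$, let $C_1,\dots,C_m\in\mathbb R_+^{n\times n}$ be cost matrices with largest entries $\|C_l\|_\infty$, let $w_l>0$ with $\sum_{l=1}^m w_l=1$, and let $\varepsilon>0$. Let $\Pi(p,q)$ be the set of nonnegative $n\times n$ matrices with row sums $p$ and column sums $q$, $H(\pi)=\sum_{i,j}\pi_{ij}(\ln\pi_{ij}-1)$, and for the cost matrix $C_l$ put $$\mathcal W(p,q)=\min_{\pi\in\Pi(p,q)}\langle\pi,C_l\rangle,\qquad \mathcal W_{\gamma}(p,q)=\min_{\pi\in\Pi(p,q)}\{\langle\pi,C_l\rangle+\gamma H(\pi)\},\qquad \mathcal W^*_{\gamma,p}(u)=\max_{q\in S_n(1)}\{\langle u,q\rangle-\mathcal W_\gamma(p,q)\}$$ (the matrix $C_l$ always belongs to $p_l$). Let $\bar W\in\mathbb R^{m\times m}$ be symmetric positive semidefinite with $\operatorname{Ker}\bar W=\operatorname{span}(\mathbb 1)$, $W=\bar W\otimes I_n$; let $\lambda_{\max}$ and $\lambda^+_{\min}$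 denote the largest and the smallest nonzero eigenvalue, and $\chi=\lambda_{\max}/\lambda_{\min}^+$. Algorithm. Replace each $p_l$ by some $\tilde p_l\in S_n(1)$ with $\|\tilde p_l-p_l\|_1\le\varepsilon/4$ and $\min_i[\tilde p_l]_i\ge\varepsilon/(8n)$, e.g. (if $\varepsilon<8$) by $\tilde p_l=(1-\frac\varepsilon8)(p_l+\frac{\varepsilon}{n(8-\varepsilon)}\mathbb 1)$. Put $\gamma=\frac{\varepsilon}{4m\ln n}$, $\gamma(l)=\gamma/w_l=\frac{\varepsilon}{4mw_l\ln n}$, $L=\lambda_{\max}(W)/\gamma$, $A_0=0$, $\zeta^0_l=\eta^0_l=q^0_l=0\in\mathbb R^n$. For $k=0,\dots,N-1$ let $\alpha_{k+1}$ be the largest root of $A_k+\alpha_{k+1}=2L\alpha_{k+1}^2$, $A_{k+1}=A_k+\alpha_{k+1}$, and for all $l$ $$\lambda^{k+1}_l=\frac{\alpha_{k+1}\zeta^k_l+A_k\eta^k_l}{A_{k+1}},\quad g_l=\nabla\mathcal W^*_{\gamma(l),\tilde p_l}(\lambda^{k+1}_l),\quad [g_l]_i=\sum_{j=1}^n[\tilde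 p_l]_j\frac{\exp(([\lambda_l^{k+1}]_i-[C_l]_{ji})/\gamma(l))}{\sum_{r=1}^n\exp(([\lambda_l^{k+1}]_r-[C_l]_{jr})/\gamma(l))},$$ $$\zeta^{k+1}_l=\zeta^k_l-\frac{\alpha_{k+1}}{w_l}\sum_{j=1}^m\bar W_{lj}g_j,\quad \eta^{k+1}_l=\frac{\alpha_{k+1}\zeta^{k+1}_l+A_k\eta^k_l}{A_{k+1}},\quad q^{k+1}_l=\frac{\alpha_{k+1}g_l+A_kq^k_l}{A_{k+1}}.$$ The output is $\mathtt q^N=[q_1^N,\dots,q_m^N]$. Accuracy. Let $R^2=\dfrac{n\sum_l w_l^2\|C_l\|_\infty^2}{\lambda^+_{\min}(W)}$. For every integer $$N\ge\max\Big\{1,\ \frac1\varepsilon\sqrt{64\,\chi(\bar W)\,m\,n\ln n\sum_{l=1}^m w_l^2\|C_l\|_\infty^2}\Big\}$$ the vectors $q_1^N,\dots,q_m^N$ lie in $S_n(1)$, and 1. for every $q^*\in S_n(1)$, in particular for every solution $q^*$ of the barycenter problem $\min_{q\in S_n(1)}\sum_l w_l\mathcal W(\tilde p_l,q)$, $$\sum_{l=1}^m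 w_l\mathcal W(\tilde p_l,q_l^N)-\sum_{l=1}^m w_l\mathcal W(\tilde p_l,q^*)\le\varepsilon;$$ for the measures $p_l$ before the replacement the same holds with the bound $\frac\varepsilon2+\frac\varepsilon4\sum_l w_l\|C_l\|_\infty$ (which is at most $\varepsilon$ if $\sum_l w_l\|C_l\|_\infty\le2$); 2. the dual problem $\min_{u\in\mathbb R^{mn}}\sum_l w_l\mathcal W^*_{\gamma(l),\tilde p_l}([\sqrt W u]_l/w_l)$ has a solution $u^*$ with $\|u^*\|_2\le R$, and $\|\sqrt W\mathtt q^N\|_2\le\varepsilon/(2R)$ (read as $\sqrt W\mathtt q^N=0$ if $R=0$). If moreover $N\ge\frac1\varepsilon\sqrt{256\,\chi(\bar W)mn\ln n\sum_l w_l^2\|C_l\|^2_\infty}$, this bound also holds with $\sqrt2R$ in place of $R$. Cost. There is an absolute constant $K$ such that for all $m,n\ge2$, all $N\ge1$ and all such $\bar W$, the explicit replacement $\tilde p_l$ and all iterates $A_k,\lambda^k_l,\zeta^k_l,\eta^k_l,q^k_l$, $k=1,\dots,N$, can be computed from $p,w,C,\bar W,\varepsilon,L$ with at most $K\cdot N\cdot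 n\,(mn+\operatorname{nnz}(\bar W))$ arithmetic operations ($+,-,\times,\div,\sqrt{\ },\exp,\ln$ on reals and writing an integer constant, each at unit cost), by a straight-line program that depends only on $m,n,N$ and on the positions of the nonzero entries of $\bar W$; $\operatorname{nnz}$ is the number of these. -/

import Mathlib

noncomputable section

namespace WassersteinBarycenter

/-! ### Optimal transport -/

/-- `⟨π, C⟩`. -/
def cost {n : ℕ} (C π : Matrix (Fin n) (Fin n) ℝ) : ℝ := ∑ i, ∑ j, π i j * C i j

/-- Couplings of `p` (row sums) and `q` (column sums). -/
def couplings {n : ℕ} (p q : Fin n → ℝ) : Set (Matrix (Fin n) (Fin n) ℝ) :=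
  {π | (∀ i j, 0 ≤ π i j) ∧ (∀ i, ∑ j, π i j = p i) ∧ ∀ j, ∑ i, π i j = q j}

/-- The optimal transport cost `𝒲(p, q)`; the infimum is a minimum for `p, q` in the simplex. -/
def otCost {n : ℕ} (C : Matrix (Fin n) (Fin n) ℝ) (p q : Fin n → ℝ) : ℝ :=
  sInf (cost C '' couplings p q)

/-- `H(π) = ∑ π_ij (ln π_ij - 1)`, with `0 ln 0 = 0`. -/
def negEntropy {n : ℕ} (π : Matrix (Fin n) (Fin n) ℝ) : ℝ :=
  ∑ i, ∑ j, π i j * (Real.log (π i j) - 1)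

/-- The regularized transport cost `𝒲_γ(p, q)`. -/
def regOtCost {n : ℕ} (γ : ℝ) (C : Matrix (Fin n) (Fin n) ℝ) (p q : Fin n → ℝ) : ℝ :=
  sInf ((fun π => cost C π + γ * negEntropy π) '' couplings p q)

/-- The Fenchel-Legendre transform of `𝒲_γ(p, ·)`, whose domain is the simplex. -/
def regOtConj {n : ℕ} (γ : ℝ) (C : Matrix (Fin n) (Fin n) ℝ) (p u : Fin n → ℝ) : ℝ :=
  sSup ((fun q => ∑ i, u i * q i - regOtCost γ C p q) '' stdSimplex ℝ (Fin n))

/-- `‖C‖_∞`, the maximal element of the matrix. -/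
def maxEntry {n : ℕ} (C : Matrix (Fin n) (Fin n) ℝ) : ℝ := ⨆ ij : Fin n × Fin n, C ij.1 ij.2

/-! ### Spectral quantities of a symmetric positive semidefinite matrix -/

/-- The largest eigenvalue. -/
def lamMax {ι : Type*} [Fintype ι] [DecidableEq ι] (M : Matrix ι ι ℝ) : ℝ :=
  sSup (spectrum ℝ M)

/-- The smallest nonzero eigenvalue. -/
def lamMinPos {ι : Type*} [Fintype ι] [DecidableEq ι] (M : Matrix ι ι ℝ) : ℝ :=
  sInf {μ | μ ∈ spectrum ℝ M ∧ μ ≠ 0}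

/-- The condition number `χ = λ_max / λ⁺_min`. -/
def condNumber {ι : Type*} [Fintype ι] [DecidableEq ι] (M : Matrix ι ι ℝ) : ℝ :=
  lamMax M / lamMinPos M

/-- The number of nonzero entries. -/
def nnz {m : ℕ} (M : Matrix (Fin m) (Fin m) ℝ) : ℕ :=
  {e : Fin m × Fin m | M e.1 e.2 ≠ 0}.ncard

/-- `W = W̄ ⊗ I_n`. -/
def bigW {m : ℕ} (n : ℕ) (Wbar : Matrix (Fin m) (Fin m) ℝ) :
    Matrix (Fin m × Fin n) (Fin m × Fin n) ℝ :=
  Matrix.kroneckerMap (· * ·) Wbar (1 : Matrix (Fin n) (Fin n) ℝ)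

open scoped MatrixOrder in
/-- `√W`, the positive semidefinite square root of `W = W̄ ⊗ I_n`. -/
def sqrtW {m : ℕ} (n : ℕ) (Wbar : Matrix (Fin m) (Fin m) ℝ) :
    Matrix (Fin m × Fin n) (Fin m × Fin n) ℝ :=
  CFC.sqrt (bigW n Wbar)

/-- The Euclidean norm. -/
def norm2 {ι : Type*} [Fintype ι] (x : ι → ℝ) : ℝ := ‖WithLp.toLp 2 x‖

/-- The vector of `ℝ^{mn}` with blocks `q_1, …, q_m`. -/
def stack {m n : ℕ} (q : Fin m → Fin n → ℝ) : Fin m × Fin n → ℝ := fun x => q x.1 x.2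

/-! ### The algorithm -/

/-- `γ(l) = ε / (4 m w_l ln n)`. -/
def gam {m : ℕ} (n : ℕ) (ε : ℝ) (w : Fin m → ℝ) (l : Fin m) : ℝ :=
  ε / (4 * m * w l * Real.log n)

/-- The dual objective `u ↦ ∑_l w_l 𝒲*_{γ(l), p_l}([√W u]_l / w_l)`. -/
def dualObjective {m n : ℕ} (ε : ℝ) (w : Fin m → ℝ) (C : Fin m → Matrix (Fin n) (Fin n) ℝ)
    (Wbar : Matrix (Fin m) (Fin m) ℝ) (p : Fin m → Fin n → ℝ) (u : Fin m × Fin n → ℝ) : ℝ :=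
  ∑ l, w l * regOtConj (gam n ε w l) (C l) (p l)
    (fun i => Matrix.mulVec (sqrtW n Wbar) u (l, i) / w l)

/-- The Lipschitz constant `L = λ_max(W) / γ`, `γ = ε / (4 m ln n)`, of the gradient of the dual
objective. -/
def lipConst {m : ℕ} (n : ℕ) (ε : ℝ) (Wbar : Matrix (Fin m) (Fin m) ℝ) : ℝ :=
  lamMax (bigW n Wbar) / (ε / (4 * m * Real.log n))

/-- What the agents are given. -/
structure Input (m n : ℕ) where
  p : Fin m → Fin n → ℝ
  w : Fin m → ℝ
  C : Fin m → Matrix (Fin n) (Fin n) ℝ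
  Wbar : Matrix (Fin m) (Fin m) ℝ
  ε : ℝ
  L : ℝ

/-- `p'` may replace `p` at the start of the algorithm. -/
def Admissible {n : ℕ} (ε : ℝ) (p p' : Fin n → ℝ) : Prop :=
  p' ∈ stdSimplex ℝ (Fin n) ∧ ∑ i, |p' i - p i| ≤ ε / 4 ∧ ∀ i, ε / (8 * n) ≤ p' i

/-- The explicit replacement `(1 - ε/8) (p + ε / (n (8 - ε)) 𝟙)`. -/
def smooth {n : ℕ} (ε : ℝ) (p : Fin n → ℝ) : Fin n → ℝ :=
  fun i => (1 - ε / 8) * (p i + ε / (n * (8 - ε)))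

theorem admissible_smooth {n : ℕ} {ε : ℝ} (hε : 0 < ε) (hε8 : ε < 8) {p : Fin n → ℝ}
    (hp : p ∈ stdSimplex ℝ (Fin n)) : Admissible ε p (smooth ε p) := by
  have hn : (0 : ℝ) < n := by
    rcases Nat.eq_zero_or_pos n with h | h
    · subst h
      simpa using hp.2
    · exact_mod_cast h
  have h8 : 8 - ε ≠ 0 := by linarith
  have key : ∀ i, smooth ε p i = (1 - ε / 8) * p i + ε / (8 * n) := by
    intro i
    unfold smooth
    field_simp
  have hc : ∑ _i : Fin n, ε / (8 * (n : ℝ)) = ε / 8 := by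
    simp only [Finset.sum_const, Finset.card_univ, Fintype.card_fin, nsmul_eq_mul]
    field_simp
  have hpos : 0 < ε / (8 * n) := by positivity
  have hmul : ∀ i, 0 ≤ (1 - ε / 8) * p i := fun i => mul_nonneg (by linarith) (hp.1 i)
  refine ⟨⟨fun i => ?_, ?_⟩, ?_, fun i => ?_⟩
  · rw [key]
    linarith [hmul i]
  · simp only [key, Finset.sum_add_distrib, ← Finset.mul_sum, hp.2, hc]
    ring
  · calc ∑ i, |smooth ε p i - p i| ≤ ∑ i, (ε / 8 * p i + ε / (8 * n)) := by
          refine Finset.sum_le_sum fun i _ => ?_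
          have h0 : 0 ≤ ε / 8 * p i := mul_nonneg (by linarith) (hp.1 i)
          rw [key, abs_le]
          constructor <;> nlinarith
      _ = ε / 4 := by
          rw [Finset.sum_add_distrib, ← Finset.mul_sum, hp.2, hc]
          ring
  · rw [key]
    linarith [hmul i]

/-- The input after its measures have been replaced by the explicit formula. -/
def Input.smoothed {m n : ℕ} (d : Input m n) : Input m n :=
  { d with p := fun l => smooth d.ε (d.p l) }

/-- The largest root `α` of `A + α = 2 L α²`. -/
def stepSize (L A : ℝ) : ℝ := (1 + √(1 + 8 * L * A)) / (4 * L)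

theorem isGreatest_stepSize {L A : ℝ} (hL : 0 < L) (hA : 0 ≤ A) :
    IsGreatest {α : ℝ | A + α = 2 * L * α ^ 2} (stepSize L A) := by
  have h0 : 0 ≤ 1 + 8 * L * A := by positivity
  have hs := Real.sq_sqrt h0
  have hs0 := Real.sqrt_nonneg (1 + 8 * L * A)
  constructor
  · change A + stepSize L A = 2 * L * stepSize L A ^ 2
    have h1 : 4 * L * stepSize L A = 1 + √(1 + 8 * L * A) := by
      rw [stepSize]
      field_simp
    have h2 : (4 * L * stepSize L A - 1) ^ 2 = 1 + 8 * L * A := by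
      rw [h1, add_sub_cancel_left, hs]
    have h3 : L * (A + stepSize L A) = L * (2 * L * stepSize L A ^ 2) := by nlinarith
    exact mul_left_cancel₀ hL.ne' h3
  · intro α hα
    change A + α = 2 * L * α ^ 2 at hα
    rw [stepSize, le_div_iff₀ (by positivity)]
    have h1 : (4 * L * α - 1) ^ 2 = 1 + 8 * L * A := by
      have : 8 * L * (A + α) = 8 * L * (2 * L * α ^ 2) := by rw [hα]
      nlinarith
    have h2 := Real.abs_le_sqrt h1.le
    linarith [le_abs_self (4 * L * α - 1)]

/-- `∇𝒲*_{γ, p}(u)`. The index `j` of `C j i` carries the mass of `p`, as in `couplings p q`; for a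
symmetric cost matrix `C j i = C i j`. -/
def gradConj {n : ℕ} (γ : ℝ) (C : Matrix (Fin n) (Fin n) ℝ) (p u : Fin n → ℝ) (i : Fin n) : ℝ :=
  ∑ j, p j * (Real.exp ((u i - C j i) / γ) / ∑ r, Real.exp ((u r - C j r) / γ))

/-- The variables of the algorithm. -/
structure State (m n : ℕ) where
  A : ℝ
  lam : Fin m → Fin n → ℝ
  zeta : Fin m → Fin n → ℝ
  eta : Fin m → Fin n → ℝ
  q : Fin m → Fin n → ℝ

/-- One iteration. The dual variables are kept in the form `λ_l = [√W u]_l / w_l`, so that the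
gradient step in `u` becomes the update of `zeta` below. -/
def iterate {m n : ℕ} (d : Input m n) (s : State m n) : State m n :=
  let α := stepSize d.L s.A
  let A' := s.A + α
  let lam' : Fin m → Fin n → ℝ := fun l i => (α * s.zeta l i + s.A * s.eta l i) / A'
  let g : Fin m → Fin n → ℝ := fun l => gradConj (gam n d.ε d.w l) (d.C l) (d.p l) (lam' l)
  let zeta' : Fin m → Fin n → ℝ :=
    fun l i => s.zeta l i - α / d.w l * ∑ j, d.Wbar l j * g j i
  { A := A'
    lam := lam'
    zeta := zeta'
    eta := fun l i => (α * zeta' l i + s.A * s.eta l i) / A'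
    q := fun l i => (α * g l i + s.A * s.q l i) / A' }

/-- The variables after `k` iterations, started at zero. -/
def run {m n : ℕ} (d : Input m n) : ℕ → State m n
  | 0 => ⟨0, 0, 0, 0, 0⟩
  | k + 1 => iterate d (run d k)

/-! ### Counting arithmetic operations

The model is that of straight-line programs over the reals with unit cost. A value computed by a
program is a function of the data `d : D`; the program does not depend on `d`. -/

/-- `f` results from one operation applied to values that are already in memory. -/
inductive OneOp {D : Type} (S : Set (D → ℝ)) : (D → ℝ) → Prop
  | const (c : ℕ) : OneOp S (fun _ => (c : ℝ))
  | add {f g : D → ℝ} (hf : f ∈ S) (hg : g ∈ S) : OneOp S (fun d => f d + g d)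
  | sub {f g : D → ℝ} (hf : f ∈ S) (hg : g ∈ S) : OneOp S (fun d => f d - g d)
  | mul {f g : D → ℝ} (hf : f ∈ S) (hg : g ∈ S) : OneOp S (fun d => f d * g d)
  | div {f g : D → ℝ} (hf : f ∈ S) (hg : g ∈ S) : OneOp S (fun d => f d / g d)
  | sqrt {f : D → ℝ} (hf : f ∈ S) : OneOp S (fun d => √(f d))
  | exp {f : D → ℝ} (hf : f ∈ S) : OneOp S (fun d => Real.exp (f d))
  | log {f : D → ℝ} (hf : f ∈ S) : OneOp S (fun d => Real.log (f d))

/-- Some program of exactly `k` operations, whose memory initially holds `I`, ends with the memory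
contents `S`. -/
inductive Program {D : Type} (I : Set (D → ℝ)) : ℕ → Set (D → ℝ) → Prop
  | init : Program I 0 I
  | step {k : ℕ} {S : Set (D → ℝ)} {f : D → ℝ} (hS : Program I k S) (hf : OneOp S f) :
      Program I (k + 1) (insert f S)

/-- The inputs whose matrix `W̄` has nonzero entries only where `Wbar` has. -/
def InputOn {m : ℕ} (n : ℕ) (Wbar : Matrix (Fin m) (Fin m) ℝ) : Type :=
  {d : Input m n // ∀ l j, Wbar l j = 0 → d.Wbar l j = 0}

/-- The numbers that are given. -/
def inputValues {m : ℕ} (n : ℕ) (Wbar : Matrix (Fin m) (Fin m) ℝ) :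
    Set (InputOn n Wbar → ℝ) :=
  {f | (∃ l i, f = fun d => d.1.p l i) ∨ (∃ l, f = fun d => d.1.w l) ∨
    (∃ l i j, f = fun d => d.1.C l i j) ∨ (∃ l j, f = fun d => d.1.Wbar l j) ∨
    (f = fun d => d.1.ε) ∨ f = fun d => d.1.L}

/-- All the variables of iterations `1, …, N`, with the measures replaced at the start by the
explicit formula. -/
def iterateValues {m : ℕ} (n : ℕ) (Wbar : Matrix (Fin m) (Fin m) ℝ) (N : ℕ) :
    Set (InputOn n Wbar → ℝ) :=
  {f | ∃ k, 1 ≤ k ∧ k ≤ N ∧ ((f = fun d => (run d.1.smoothed k).A) ∨ ∃ l i,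
    (f = fun d => (run d.1.smoothed k).lam l i) ∨ (f = fun d => (run d.1.smoothed k).zeta l i) ∨
    (f = fun d => (run d.1.smoothed k).eta l i) ∨ f = fun d => (run d.1.smoothed k).q l i)}

/-! ### The quantities in the bounds -/

/-- `(1/ε) √(c χ(W̄) m n ln n ∑_l w_l² ‖C_l‖_∞²)`. -/
def iterBound {m n : ℕ} (c ε : ℝ) (w : Fin m → ℝ) (C : Fin m → Matrix (Fin n) (Fin n) ℝ)
    (Wbar : Matrix (Fin m) (Fin m) ℝ) : ℝ :=
  1 / ε * √(c * condNumber Wbar * m * n * Real.log n * ∑ l, w l ^ 2 * maxEntry (C l) ^ 2)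

/-- `√(c n ∑_l w_l² ‖C_l‖_∞² / λ⁺_min(W))`. -/
def dualRadius {m n : ℕ} (c : ℝ) (w : Fin m → ℝ) (C : Fin m → Matrix (Fin n) (Fin n) ℝ)
    (Wbar : Matrix (Fin m) (Fin m) ℝ) : ℝ :=
  √(c * n * (∑ l, w l ^ 2 * maxEntry (C l) ^ 2) / lamMinPos (bigW n Wbar))

end WassersteinBarycenter

end

/-! Write `φ(u)` for the dual objective and `P(π)` for the weighted sum of the regularized transport
objectives of plans `π_l` with row sums `p_l`. For fixed row sums the maximum defining `𝒲*`
separates over rows. It is attained at the Gibbs plan, whose column sums are the gradient, and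
equals a sum of log-partition functions (`regOtConj_eq_conjVal`). Fenchel-Young is Gibbs' inequality
row by row (`sum_mul_sub_planValue_le`), and a cosh estimate bounds the growth of log-sum-exp
(`conjVal_add_le_of_smooth`). As `w_l γ(l) = γ` for all agents, `φ` lies below its linearization
plus `L‖·‖²`.

The algorithm is the method of similar triangles for `φ`, written in the variables `λ_l = [√W u]_l /
w_l`. Besides the dual points `z`, `y` behind `ζ`, `η`, the proof follows the average `π` of the
Gibbs plans, whose column sums are `q`. The invariant is `A (φ(y) + P(π)) ≤ -‖z‖²/2` with `z = -A √W
q` (`Certificate`). It propagates because the constant term of the linearization of `φ` at `x` is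
`-P` of the Gibbs plans at `x`, and `P` is convex. The step size gives `8 L A_N ≥ N²`.

Both accuracy claims follow from the invariant. Compared with plans that share one second marginal,
weak duality has no linear term, since `√W` kills constant stacks. So `P(π)` is no larger than the
competing value, and the entropy varies by at most `2 ln n` per agent, which costs `ε/2` in total
(`gap_le`). Compared with a dual solution `u*`, weak duality gives `A ‖√W q‖ ≤ 2‖u*‖`
(`A_mul_norm2_le`), and the growth of `A_N` finishes (`norm2_consensus_le`).

A dual solution of norm at most `R/2` is found by one exact block minimization: with the row
scalings frozen, the best column potentials are explicit logarithms that oscillate by at most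
`‖C_l‖_∞ / γ(l)`. Each admissible point is thus dominated by one in a fixed compact set
(`exists_sepObj_min`), and lifting through `√W` costs the factor `1/λ⁺_min`.

The operation count is an explicit program: `m n²` exponentials, each normalizing constant computed
once, and sums with `W̄` taken over its nonzero entries only. -/

noncomputable section

namespace WassersteinBarycenter

/-! ### Spectral bounds -/

open Matrix
open scoped MatrixOrder

section Spectral

variable {ι : Type*} [Fintype ι] [DecidableEq ι] {M : Matrix ι ι ℝ}

theorem finite_spectrum (hM : M.PosSemidef) : (spectrum ℝ M).Finite := by
  rw [hM.isHermitian.spectrum_real_eq_range_eigenvalues]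
  exact Set.finite_range _

theorem nonneg_of_mem_spectrum (hM : M.PosSemidef) {μ : ℝ} (hμ : μ ∈ spectrum ℝ M) : 0 ≤ μ := by
  rw [hM.isHermitian.spectrum_real_eq_range_eigenvalues] at hμ
  obtain ⟨i, rfl⟩ := hμ
  exact hM.eigenvalues_nonneg i

theorem le_lamMax (hM : M.PosSemidef) {μ : ℝ} (hμ : μ ∈ spectrum ℝ M) : μ ≤ lamMax M :=
  le_csSup (finite_spectrum hM).bddAbove hμ

theorem lamMinPos_le (hM : M.PosSemidef) {μ : ℝ} (hμ : μ ∈ spectrum ℝ M) (h0 : μ ≠ 0) :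
    lamMinPos M ≤ μ :=
  csInf_le (((finite_spectrum hM).subset (Set.sep_subset _ _)).bddBelow) ⟨hμ, h0⟩

theorem exists_mem_spectrum_ne_zero (hM : M.PosSemidef) (h0 : M ≠ 0) :
    ∃ μ ∈ spectrum ℝ M, μ ≠ 0 := by
  by_contra! h
  apply h0
  have : hM.isHermitian.eigenvalues = 0 := by
    funext i
    apply h
    rw [hM.isHermitian.spectrum_real_eq_range_eigenvalues]
    exact ⟨i, rfl⟩
  exact hM.isHermitian.eigenvalues_eq_zero_iff.1 this

/-- The set of nonzero eigenvalues is finite and, because `M ≠ 0`, nonempty, so the infimum is one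
of them and not the default value `sInf ∅ = 0`. -/
theorem lamMinPos_pos (hM : M.PosSemidef) (h0 : M ≠ 0) : 0 < lamMinPos M := by
  obtain ⟨μ, hμ, hμ0⟩ := exists_mem_spectrum_ne_zero hM h0
  have hne : {μ | μ ∈ spectrum ℝ M ∧ μ ≠ 0}.Nonempty := ⟨μ, hμ, hμ0⟩
  have := hne.csInf_mem ((finite_spectrum hM).subset (Set.sep_subset _ _))
  exact lt_of_le_of_ne (nonneg_of_mem_spectrum hM this.1) (Ne.symm this.2)

theorem lamMax_pos (hM : M.PosSemidef) (h0 : M ≠ 0) : 0 < lamMax M := by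
  obtain ⟨μ, hμ, hμ0⟩ := exists_mem_spectrum_ne_zero hM h0
  exact (lt_of_le_of_ne (nonneg_of_mem_spectrum hM hμ) (Ne.symm hμ0)).trans_le (le_lamMax hM hμ)

/-- Functional calculus: `λ_max - μ ≥ 0` on the spectrum. -/
theorem dotProduct_mulVec_le_lamMax (hM : M.PosSemidef) (x : ι → ℝ) :
    x ⬝ᵥ M *ᵥ x ≤ lamMax M * (x ⬝ᵥ x) := by
  have hsa : IsSelfAdjoint M := hM.isHermitian
  have h : 0 ≤ cfc (fun μ : ℝ => lamMax M - μ) M :=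
    cfc_nonneg fun μ hμ => sub_nonneg.2 (le_lamMax hM hμ)
  rw [cfc_sub (fun _ : ℝ => lamMax M) (fun μ => μ) M, cfc_const (lamMax M) M, cfc_id' ℝ M] at h
  have := (nonneg_iff_posSemidef.1 h).dotProduct_mulVec_nonneg x
  simp only [star_trivial, Matrix.sub_mulVec, dotProduct_sub, Algebra.algebraMap_eq_smul_one,
    smul_mulVec, one_mulVec, dotProduct_smul, smul_eq_mul] at this
  linarith

/-- Functional calculus for `μ² - λ⁺_min μ`, which is nonnegative on the spectrum and vanishes at
the eigenvalue `0`. -/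
theorem lamMinPos_mul_le (hM : M.PosSemidef) (x : ι → ℝ) :
    lamMinPos M * (x ⬝ᵥ M *ᵥ x) ≤ (M *ᵥ x) ⬝ᵥ (M *ᵥ x) := by
  have hsa : IsSelfAdjoint M := hM.isHermitian
  have h : 0 ≤ cfc (fun μ : ℝ => μ * μ - lamMinPos M * μ) M := by
    refine cfc_nonneg fun μ hμ => ?_
    rcases eq_or_ne μ 0 with rfl | h0
    · simp
    · nlinarith [lamMinPos_le hM hμ h0, nonneg_of_mem_spectrum hM hμ]
  rw [cfc_sub (fun μ : ℝ => μ * μ) (fun μ => lamMinPos M * μ) M, cfc_mul (fun μ : ℝ => μ)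
    (fun μ : ℝ => μ) M, cfc_const_mul (lamMinPos M) (fun μ : ℝ => μ) M, cfc_id' ℝ M] at h
  have := (nonneg_iff_posSemidef.1 h).dotProduct_mulVec_nonneg x
  have hT : Mᵀ = M := by simpa using hM.isHermitian.eq
  have h2 : (M *ᵥ x) ⬝ᵥ (M *ᵥ x) = x ⬝ᵥ (M * M) *ᵥ x := by
    rw [← mulVec_mulVec, dotProduct_mulVec x, ← mulVec_transpose, hT]
  rw [h2]
  simp only [star_trivial, Matrix.sub_mulVec, dotProduct_sub, smul_mulVec, dotProduct_smul,
    smul_eq_mul] at this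
  linarith

end Spectral

/-! ### The matrix `W̄ ⊗ I_n`, its square root and their ranges -/

section Kronecker

variable {m : ℕ} {n : ℕ} {Wbar : Matrix (Fin m) (Fin m) ℝ}

theorem posSemidef_bigW (hW : Wbar.PosSemidef) : (bigW n Wbar).PosSemidef :=
  hW.kronecker PosSemidef.one

/-- `μ - W̄ ⊗ I = (μ - W̄) ⊗ I`, whose determinant is the `n`-th power of that of `μ - W̄`. -/
theorem spectrum_bigW (hn : n ≠ 0) : spectrum ℝ (bigW n Wbar) = spectrum ℝ Wbar := by
  ext μ
  have h : algebraMap ℝ (Matrix (Fin m × Fin n) (Fin m × Fin n) ℝ) μ - bigW n Wbar =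
      kroneckerMap (· * ·) (algebraMap ℝ (Matrix (Fin m) (Fin m) ℝ) μ - Wbar)
        (1 : Matrix (Fin n) (Fin n) ℝ) := by
    ext ⟨l, i⟩ ⟨j, r⟩
    simp only [bigW, Algebra.algebraMap_eq_smul_one, Matrix.sub_apply, Matrix.smul_apply,
      smul_eq_mul, kroneckerMap_apply, one_apply, Prod.mk.injEq]
    split_ifs <;> simp_all
  rw [spectrum.mem_iff, spectrum.mem_iff, h, isUnit_iff_isUnit_det, isUnit_iff_isUnit_det]
  have hd := det_kronecker (algebraMap ℝ (Matrix (Fin m) (Fin m) ℝ) μ - Wbar)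
    (1 : Matrix (Fin n) (Fin n) ℝ)
  rw [det_one, one_pow, mul_one, Fintype.card_fin] at hd
  erw [hd]
  rw [isUnit_pow_iff hn]

theorem lamMax_bigW (hn : n ≠ 0) : lamMax (bigW n Wbar) = lamMax Wbar := by
  rw [lamMax, spectrum_bigW hn, lamMax]

theorem lamMinPos_bigW (hn : n ≠ 0) : lamMinPos (bigW n Wbar) = lamMinPos Wbar := by
  rw [lamMinPos, spectrum_bigW hn, lamMinPos]

theorem bigW_mulVec (v : Fin m × Fin n → ℝ) (l : Fin m) (i : Fin n) :
    (bigW n Wbar *ᵥ v) (l, i) = ∑ j, Wbar l j * v (j, i) := by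
  simp [bigW, mulVec, dotProduct, Fintype.sum_prod_type, one_apply]

theorem sqrtW_mul_sqrtW (hW : Wbar.PosSemidef) : sqrtW n Wbar * sqrtW n Wbar = bigW n Wbar :=
  CFC.sqrt_mul_sqrt_self _ (posSemidef_bigW hW).nonneg

theorem transpose_sqrtW : (sqrtW n Wbar)ᵀ = sqrtW n Wbar := by
  have : (sqrtW n Wbar).PosSemidef := nonneg_iff_posSemidef.1 (CFC.sqrt_nonneg _)
  simpa using this.isHermitian.eq

theorem sqrtW_mulVec_dotProduct (x y : Fin m × Fin n → ℝ) :
    (sqrtW n Wbar *ᵥ x) ⬝ᵥ y = x ⬝ᵥ sqrtW n Wbar *ᵥ y := by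
  rw [dotProduct_mulVec, ← mulVec_transpose, transpose_sqrtW]

theorem sqrtW_mulVec_dotProduct_self (hW : Wbar.PosSemidef) (x : Fin m × Fin n → ℝ) :
    (sqrtW n Wbar *ᵥ x) ⬝ᵥ (sqrtW n Wbar *ᵥ x) = x ⬝ᵥ bigW n Wbar *ᵥ x := by
  rw [sqrtW_mulVec_dotProduct, mulVec_mulVec, sqrtW_mul_sqrtW hW]

theorem ne_zero_of_ker (hm : 2 ≤ m)
    (hker : LinearMap.ker Wbar.mulVecLin = Submodule.span ℝ {fun _ => (1 : ℝ)}) : Wbar ≠ 0 := by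
  rintro rfl
  have h : (Pi.single ⟨0, by omega⟩ 1 : Fin m → ℝ) ∈ Submodule.span ℝ {fun _ => (1 : ℝ)} := by
    rw [← hker]
    simp
  obtain ⟨a, ha⟩ := Submodule.mem_span_singleton.1 h
  have h0 := congrFun ha ⟨0, by omega⟩
  have h1 := congrFun ha ⟨1, by omega⟩
  simp at h0 h1
  linarith

theorem bigW_ne_zero (hn : n ≠ 0) (h : Wbar ≠ 0) : bigW n Wbar ≠ 0 := by
  intro h0
  apply h
  ext l j
  have := congrFun (congrFun h0 (l, ⟨0, Nat.pos_of_ne_zero hn⟩)) (j, ⟨0, Nat.pos_of_ne_zero hn⟩)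
  simpa [bigW] using this

theorem mulVec_const_eq_zero
    (hker : LinearMap.ker Wbar.mulVecLin = Submodule.span ℝ {fun _ => (1 : ℝ)}) (l : Fin m) :
    ∑ j, Wbar l j = 0 := by
  have h : (fun _ => (1 : ℝ)) ∈ LinearMap.ker Wbar.mulVecLin := by
    rw [hker]
    exact Submodule.mem_span_singleton_self _
  have := congrFun (LinearMap.mem_ker.1 h) l
  simpa [mulVec, dotProduct] using this

theorem sqrtW_mulVec_const (hW : Wbar.PosSemidef)
    (hker : LinearMap.ker Wbar.mulVecLin = Submodule.span ℝ {fun _ => (1 : ℝ)}) (q : Fin n → ℝ) :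
    sqrtW n Wbar *ᵥ (fun x : Fin m × Fin n => q x.2) = 0 := by
  rw [← dotProduct_self_eq_zero, sqrtW_mulVec_dotProduct_self hW]
  have : bigW n Wbar *ᵥ (fun x : Fin m × Fin n => q x.2) = 0 := by
    ext ⟨l, i⟩
    rw [bigW_mulVec]
    simp [← Finset.sum_mul, mulVec_const_eq_zero hker]
  rw [this, dotProduct_zero]

/-- The range of a self-adjoint map is the orthogonal complement of its kernel, here of the
constants. -/
theorem mem_range_mulVec (hW : Wbar.PosSemidef)
    (hker : LinearMap.ker Wbar.mulVecLin = Submodule.span ℝ {fun _ => (1 : ℝ)})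
    {v : Fin m → ℝ} (hv : ∑ l, v l = 0) : ∃ y, Wbar *ᵥ y = v := by
  set T : EuclideanSpace ℝ (Fin m) →ₗ[ℝ] EuclideanSpace ℝ (Fin m) := toEuclideanLin Wbar with hT
  have hsym : T.IsSymmetric := isSymmetric_toEuclideanLin_iff.2 hW.isHermitian
  have hmem : WithLp.toLp 2 v ∈ LinearMap.range T := by
    have hadj : T.adjoint = T := (LinearMap.isSymmetric_iff_isSelfAdjoint T).1 hsym
    rw [← hadj, ← LinearMap.orthogonal_ker]
    rw [Submodule.mem_orthogonal]
    intro u hu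
    have hu' : (WithLp.ofLp u) ∈ LinearMap.ker Wbar.mulVecLin := by
      rw [LinearMap.mem_ker] at hu ⊢
      have := congrArg WithLp.ofLp hu
      simpa [hT, toEuclideanLin] using this
    rw [hker] at hu'
    obtain ⟨a, ha⟩ := Submodule.mem_span_singleton.1 hu'
    simp only [PiLp.inner_apply, ← ha]
    simp [← Finset.sum_mul, hv]
  obtain ⟨y, hy⟩ := hmem
  refine ⟨WithLp.ofLp y, ?_⟩
  have := congrArg WithLp.ofLp hy
  simpa [hT, toEuclideanLin] using this

/-- Solve `W y = v` coordinatewise in `Fin n` and put `u = √W y`. Then `‖u‖² = ⟨y, W y⟩ ≤ ‖W y‖² /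
λ⁺_min`. -/
theorem exists_sqrtW_mulVec_eq (hn : n ≠ 0) (hm : 2 ≤ m) (hW : Wbar.PosSemidef)
    (hker : LinearMap.ker Wbar.mulVecLin = Submodule.span ℝ {fun _ => (1 : ℝ)})
    {v : Fin m → Fin n → ℝ} (hv : ∀ i, ∑ l, v l i = 0) :
    ∃ u : Fin m × Fin n → ℝ, sqrtW n Wbar *ᵥ u = stack v ∧
      u ⬝ᵥ u ≤ (stack v ⬝ᵥ stack v) / lamMinPos (bigW n Wbar) := by
  choose y hy using fun i => mem_range_mulVec hW hker (v := fun l => v l i) (hv i)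
  have hy' : bigW n Wbar *ᵥ (fun x => y x.2 x.1) = stack v := by
    ext ⟨l, i⟩
    rw [bigW_mulVec]
    exact congrFun (hy i) l
  refine ⟨sqrtW n Wbar *ᵥ (fun x => y x.2 x.1), ?_, ?_⟩
  · rw [mulVec_mulVec, sqrtW_mul_sqrtW hW, hy']
  · rw [sqrtW_mulVec_dotProduct_self hW, le_div_iff₀' (lamMinPos_pos (posSemidef_bigW hW)
      (bigW_ne_zero hn (ne_zero_of_ker hm hker))), ← hy']
    exact lamMinPos_mul_le (posSemidef_bigW hW) _

theorem norm2_sq {ι : Type*} [Fintype ι] (x : ι → ℝ) : norm2 x ^ 2 = x ⬝ᵥ x := by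
  rw [norm2, EuclideanSpace.norm_sq_eq]
  simp [dotProduct, sq]

end Kronecker

/-! ### The conjugate of the regularized transport cost -/

section Conjugate

variable {n : ℕ} {γ : ℝ} {C : Matrix (Fin n) (Fin n) ℝ} {p q u : Fin n → ℝ}

/-- The objective `⟨π, C⟩ + γ H(π)` of the regularized transport problem. -/
def planValue (γ : ℝ) (C π : Matrix (Fin n) (Fin n) ℝ) : ℝ := cost C π + γ * negEntropy π

/-- The normalizing constant of the row `j` of the Gibbs plan. -/
def partFn (γ : ℝ) (C : Matrix (Fin n) (Fin n) ℝ) (u : Fin n → ℝ) (j : Fin n) : ℝ :=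
  ∑ r, Real.exp ((u r - C j r) / γ)

/-- The plan with row sums `p` that attains `𝒲*_{γ, p}(u)`. -/
def gibbsPlan (γ : ℝ) (C : Matrix (Fin n) (Fin n) ℝ) (p u : Fin n → ℝ) :
    Matrix (Fin n) (Fin n) ℝ :=
  fun j i => p j * (Real.exp ((u i - C j i) / γ) / partFn γ C u j)

/-- The closed form of `𝒲*_{γ, p}(u)`. -/
def conjVal (γ : ℝ) (C : Matrix (Fin n) (Fin n) ℝ) (p u : Fin n → ℝ) : ℝ :=
  γ * ∑ j, p j * (Real.log (partFn γ C u j) - Real.log (p j)) + γ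

theorem partFn_pos (j : Fin n) : 0 < partFn γ C u j :=
  Finset.sum_pos (fun _ _ => Real.exp_pos _) ⟨j, Finset.mem_univ j⟩

theorem gradConj_eq_sum (i : Fin n) : gradConj γ C p u i = ∑ j, gibbsPlan γ C p u j i := rfl

theorem sum_softmax (j : Fin n) :
    ∑ i, Real.exp ((u i - C j i) / γ) / partFn γ C u j = 1 := by
  rw [← Finset.sum_div]
  exact div_self (partFn_pos j).ne'

theorem gibbsPlan_mem (hp : p ∈ stdSimplex ℝ (Fin n)) :
    gibbsPlan γ C p u ∈ couplings p (gradConj γ C p u) := by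
  refine ⟨fun j i => mul_nonneg (hp.1 j) (div_nonneg (Real.exp_pos _).le (partFn_pos j).le),
    fun j => ?_, fun i => rfl⟩
  simp only [gibbsPlan]
  rw [← Finset.mul_sum, sum_softmax, mul_one]

theorem sum_of_mem_couplings {π : Matrix (Fin n) (Fin n) ℝ} (h : π ∈ couplings p q) :
    ∑ i, q i = ∑ j, p j := by
  calc ∑ i, q i = ∑ i, ∑ j, π j i := Finset.sum_congr rfl fun i _ => (h.2.2 i).symm
    _ = ∑ j, ∑ i, π j i := Finset.sum_comm
    _ = ∑ j, p j := Finset.sum_congr rfl fun j _ => h.2.1 j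

theorem mem_stdSimplex_of_mem_couplings {π : Matrix (Fin n) (Fin n) ℝ}
    (hp : p ∈ stdSimplex ℝ (Fin n)) (h : π ∈ couplings p q) : q ∈ stdSimplex ℝ (Fin n) := by
  refine ⟨fun i => ?_, (sum_of_mem_couplings h).trans hp.2⟩
  rw [← h.2.2 i]
  exact Finset.sum_nonneg fun j _ => h.1 j i

theorem gradConj_mem (hp : p ∈ stdSimplex ℝ (Fin n)) :
    gradConj γ C p u ∈ stdSimplex ℝ (Fin n) :=
  mem_stdSimplex_of_mem_couplings hp (gibbsPlan_mem hp)

theorem product_mem_couplings (hp : p ∈ stdSimplex ℝ (Fin n)) (hq : q ∈ stdSimplex ℝ (Fin n)) :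
    (fun j i => p j * q i : Matrix (Fin n) (Fin n) ℝ) ∈ couplings p q := by
  refine ⟨fun j i => mul_nonneg (hp.1 j) (hq.1 i), fun j => ?_, fun i => ?_⟩
  · rw [← Finset.mul_sum, hq.2, mul_one]
  · rw [← Finset.sum_mul, hp.2, one_mul]

/-- The pointwise form of Gibbs' inequality, from `log s ≤ s - 1` at `s = t / x`. Summed over two
measures of equal mass, its right side disappears. -/
theorem mul_log_sub_mul_log_le {x t : ℝ} (hx : 0 ≤ x) (ht : 0 < t) :
    x * Real.log t - x * Real.log x ≤ t - x := by
  rcases hx.eq_or_lt with rfl | hx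
  · simpa using ht.le
  · have h := Real.log_le_sub_one_of_pos (div_pos ht hx)
    rw [Real.log_div ht.ne' hx.ne'] at h
    have := mul_le_mul_of_nonneg_left h hx.le
    have e : x * (t / x - 1) = t - x := by field_simp
    linarith

theorem log_gibbsPlan {j : Fin n} (hj : p j ≠ 0) (i : Fin n) :
    Real.log (gibbsPlan γ C p u j i) =
      Real.log (p j) + (u i - C j i) / γ - Real.log (partFn γ C u j) := by
  rw [gibbsPlan, Real.log_mul hj (div_pos (Real.exp_pos _) (partFn_pos j)).ne',
    Real.log_div (Real.exp_pos _).ne' (partFn_pos j).ne', Real.log_exp]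
  ring

theorem sum_mul_sub_planValue {π : Matrix (Fin n) (Fin n) ℝ} (h : π ∈ couplings p q) :
    ∑ i, u i * q i - planValue γ C π =
      ∑ j, ∑ i, (π j i * (u i - C j i) - γ * (π j i * Real.log (π j i)) + γ * π j i) := by
  have hu : ∑ i, u i * q i = ∑ j, ∑ i, π j i * u i := by
    rw [Finset.sum_comm]
    refine Finset.sum_congr rfl fun i _ => ?_
    rw [← h.2.2 i, Finset.mul_sum]
    exact Finset.sum_congr rfl fun j _ => mul_comm _ _
  rw [hu, planValue, cost, negEntropy]
  simp only [Finset.mul_sum, ← Finset.sum_add_distrib, ← Finset.sum_sub_distrib]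
  refine Finset.sum_congr rfl fun j _ => Finset.sum_congr rfl fun i _ => ?_
  ring

/-- Spreads the closed form over the entries of an arbitrary coupling, so that it can be compared
entry by entry with `sum_mul_sub_planValue`. -/
theorem conjVal_eq_sum {π : Matrix (Fin n) (Fin n) ℝ} (hp : p ∈ stdSimplex ℝ (Fin n))
    (h : π ∈ couplings p q) :
    conjVal γ C p u =
      ∑ j, ∑ i, γ * (π j i * (Real.log (partFn γ C u j) - Real.log (p j)) + π j i) := by
  have e : ∀ j, ∑ i, γ * (π j i * (Real.log (partFn γ C u j) - Real.log (p j)) + π j i) =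
      γ * (p j * (Real.log (partFn γ C u j) - Real.log (p j))) + γ * p j := by
    intro j
    rw [← Finset.mul_sum, Finset.sum_add_distrib, ← Finset.sum_mul, h.2.1 j]
    ring
  simp only [e, Finset.sum_add_distrib, ← Finset.mul_sum, hp.2]
  rw [conjVal, mul_one]

/-- The Fenchel-Young inequality. -/
theorem sum_mul_sub_planValue_le (hγ : 0 < γ) (hp : p ∈ stdSimplex ℝ (Fin n))
    {π : Matrix (Fin n) (Fin n) ℝ} (h : π ∈ couplings p q) :
    ∑ i, u i * q i - planValue γ C π ≤ conjVal γ C p u := by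
  rw [sum_mul_sub_planValue h, conjVal_eq_sum hp h]
  -- `π` and the Gibbs plan have the same row sums, so this zero may be inserted in each row. The
  -- inequality then holds entrywise.
  have hz : ∀ j, ∑ i, (π j i - gibbsPlan γ C p u j i) = 0 := by
    intro j
    rw [Finset.sum_sub_distrib, (gibbsPlan_mem hp).2.1 j, h.2.1 j, sub_self]
  refine Finset.sum_le_sum fun j _ => ?_
  rw [← sub_nonneg, ← Finset.sum_sub_distrib, ← mul_zero γ, ← hz j, Finset.mul_sum,
    ← sub_nonneg, ← Finset.sum_sub_distrib]
  refine Finset.sum_nonneg fun i _ => ?_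
  -- Rows of zero mass vanish in both plans; only the others allow logarithms to be expanded.
  rcases (hp.1 j).eq_or_lt with hj | hj
  · have h0 : π j i = 0 := by
      have := h.2.1 j
      rw [← hj] at this
      exact (Finset.sum_eq_zero_iff_of_nonneg fun i _ => h.1 j i).1 this i (Finset.mem_univ i)
    simp [h0, gibbsPlan, ← hj]
  · have ht : 0 < gibbsPlan γ C p u j i :=
      mul_pos hj (div_pos (Real.exp_pos _) (partFn_pos j))
    have key := mul_le_mul_of_nonneg_left (mul_log_sub_mul_log_le (h.1 j i) ht) hγ.le
    rw [log_gibbsPlan hj.ne'] at key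
    have e : γ * ((u i - C j i) / γ) = u i - C j i := by field_simp
    have e' : γ * (π j i * (Real.log (p j) + (u i - C j i) / γ - Real.log (partFn γ C u j)) -
        π j i * Real.log (π j i)) = π j i * (u i - C j i) + γ * (π j i * (Real.log (p j) -
          Real.log (partFn γ C u j)) - π j i * Real.log (π j i)) := by
      linear_combination π j i * e
    rw [e'] at key
    linarith

/-- The equality case of Fenchel-Young. -/
theorem planValue_gibbsPlan (hγ : 0 < γ) (hp : p ∈ stdSimplex ℝ (Fin n)) :
    planValue γ C (gibbsPlan γ C p u) = ∑ i, u i * gradConj γ C p u i - conjVal γ C p u := by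
  rw [eq_sub_iff_add_eq, ← eq_sub_iff_add_eq', sum_mul_sub_planValue (gibbsPlan_mem hp),
    conjVal_eq_sum hp (gibbsPlan_mem (γ := γ) (C := C) (u := u) hp)]
  refine Finset.sum_congr rfl fun j _ => Finset.sum_congr rfl fun i _ => ?_
  rcases eq_or_ne (p j) 0 with hj | hj
  · simp [gibbsPlan, hj]
  · rw [log_gibbsPlan hj]
    field_simp
    ring

theorem bddBelow_planValue (hγ : 0 < γ) (hp : p ∈ stdSimplex ℝ (Fin n)) :
    BddBelow (planValue γ C '' couplings p q) := by
  refine ⟨∑ i, (0 : Fin n → ℝ) i * q i - conjVal γ C p 0, ?_⟩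
  rintro _ ⟨π, hπ, rfl⟩
  linarith [sum_mul_sub_planValue_le (C := C) (u := 0) hγ hp hπ]

theorem regOtConj_eq_conjVal (hγ : 0 < γ) (hp : p ∈ stdSimplex ℝ (Fin n)) :
    regOtConj γ C p u = conjVal γ C p u := by
  have hle : ∀ q ∈ stdSimplex ℝ (Fin n), ∑ i, u i * q i - regOtCost γ C p q ≤ conjVal γ C p u := by
    intro q hq
    have : ∑ i, u i * q i - conjVal γ C p u ≤ regOtCost γ C p q := by
      refine le_csInf ⟨_, _, product_mem_couplings hp hq, rfl⟩ ?_
      rintro _ ⟨π, hπ, rfl⟩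
      have := sum_mul_sub_planValue_le (C := C) (u := u) hγ hp hπ
      rw [planValue] at this
      linarith
    linarith
  have hg := gradConj_mem (γ := γ) (C := C) (u := u) hp
  apply le_antisymm
  · refine csSup_le ⟨_, _, hg, rfl⟩ ?_
    rintro _ ⟨q, hq, rfl⟩
    exact hle q hq
  · have h1 : regOtCost γ C p (gradConj γ C p u) ≤ planValue γ C (gibbsPlan γ C p u) :=
      csInf_le (bddBelow_planValue hγ hp) ⟨_, gibbsPlan_mem hp, rfl⟩
    rw [planValue_gibbsPlan hγ hp] at h1
    refine le_trans ?_ (le_csSup ⟨conjVal γ C p u, ?_⟩ ⟨_, hg, rfl⟩)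
    · linarith
    · rintro _ ⟨q, hq, rfl⟩
      exact hle q hq

/-- The subgradient inequality: Fenchel-Young at `y`, tested on the plan that is optimal at `u`. -/
theorem conjVal_add_le (hγ : 0 < γ) (hp : p ∈ stdSimplex ℝ (Fin n)) (y : Fin n → ℝ) :
    conjVal γ C p u + ∑ i, gradConj γ C p u i * (y i - u i) ≤ conjVal γ C p y := by
  have h := sum_mul_sub_planValue_le (C := C) (u := y) hγ hp
    (gibbsPlan_mem (γ := γ) (C := C) (u := u) hp)
  rw [planValue_gibbsPlan hγ hp] at h
  have e : ∑ i, gradConj γ C p u i * (y i - u i) =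
      ∑ i, y i * gradConj γ C p u i - ∑ i, u i * gradConj γ C p u i := by
    rw [← Finset.sum_sub_distrib]
    exact Finset.sum_congr rfl fun i _ => by ring
  linarith

theorem sq_sub_div_two_le {ι : Type*} [Fintype ι] [DecidableEq ι] (x : ι → ℝ) (i j : ι) :
    (x i - x j) ^ 2 / 2 ≤ ∑ k, x k ^ 2 := by
  rcases eq_or_ne i j with rfl | hij
  · rw [sub_self]
    have := Finset.sum_nonneg fun k (_ : k ∈ Finset.univ) => sq_nonneg (x k)
    simpa using this
  · have h := Finset.sum_le_sum_of_subset_of_nonneg (Finset.subset_univ {i, j})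
      fun k _ _ => sq_nonneg (x k)
    rw [Finset.sum_pair hij] at h
    nlinarith [sq_nonneg (x i + x j)]

/-- Symmetrization. For independent copies, `E e^X · E e^{-X'} = E cosh (X - X')`. By `cosh a ≤ exp
(a²/2)` and `(a - b)²/2 ≤ a² + b²` this is at most `exp (∑ x²)`, while Jensen gives `E e^{-X'} ≥
e^{-E X}`. The coefficient `1` of `∑ x²` is not sharp, but the step rule with `2 L α²` needs no
better. -/
theorem log_sum_mul_exp_le {ι : Type*} [Fintype ι] [DecidableEq ι] {s : ι → ℝ}
    (hs : s ∈ stdSimplex ℝ ι) (x : ι → ℝ) :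
    Real.log (∑ i, s i * Real.exp (x i)) ≤ ∑ i, s i * x i + ∑ i, x i ^ 2 := by
  have hJ : ∀ z : ι → ℝ, Real.exp (∑ i, s i * z i) ≤ ∑ i, s i * Real.exp (z i) := by
    intro z
    simpa using convexOn_exp.map_sum_le (t := Finset.univ) (w := s) (p := z)
      (fun i _ => hs.1 i) hs.2 (fun i _ => Set.mem_univ _)
  have hpos : 0 < ∑ i, s i * Real.exp (x i) := (Real.exp_pos _).trans_le (hJ x)
  have hJ' := hJ (fun i => -x i)
  have e1 : ∑ i, s i * -x i = -∑ i, s i * x i := by simp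
  rw [e1] at hJ'
  have hsym : (∑ i, s i * Real.exp (x i)) * ∑ j, s j * Real.exp (-x j) =
      ∑ i, ∑ j, s i * s j * Real.cosh (x i - x j) := by
    have h1 : (∑ i, s i * Real.exp (x i)) * ∑ j, s j * Real.exp (-x j) =
        ∑ i, ∑ j, s i * s j * Real.exp (x i - x j) := by
      rw [Finset.sum_mul_sum]
      refine Finset.sum_congr rfl fun i _ => Finset.sum_congr rfl fun j _ => ?_
      rw [sub_eq_add_neg, Real.exp_add]
      ring
    have h2 : ∑ i, ∑ j, s i * s j * Real.exp (x i - x j) =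
        ∑ i, ∑ j, s i * s j * Real.exp (-(x i - x j)) := by
      rw [Finset.sum_comm]
      refine Finset.sum_congr rfl fun i _ => Finset.sum_congr rfl fun j _ => ?_
      rw [neg_sub, mul_comm (s j)]
    have h3 : ∑ i, ∑ j, s i * s j * Real.cosh (x i - x j) =
        (∑ i, ∑ j, s i * s j * Real.exp (x i - x j) +
          ∑ i, ∑ j, s i * s j * Real.exp (-(x i - x j))) / 2 := by
      simp only [← Finset.sum_add_distrib, Finset.sum_div]
      refine Finset.sum_congr rfl fun i _ => Finset.sum_congr rfl fun j _ => ?_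
      rw [Real.cosh_eq]
      ring
    rw [h3, ← h2, h1]
    ring
  have hle : ∑ i, ∑ j, s i * s j * Real.cosh (x i - x j) ≤ Real.exp (∑ k, x k ^ 2) := by
    calc ∑ i, ∑ j, s i * s j * Real.cosh (x i - x j)
        ≤ ∑ i, ∑ j, s i * s j * Real.exp (∑ k, x k ^ 2) := by
          refine Finset.sum_le_sum fun i _ => Finset.sum_le_sum fun j _ => ?_
          refine mul_le_mul_of_nonneg_left ?_ (mul_nonneg (hs.1 i) (hs.1 j))
          exact (Real.cosh_le_exp_half_sq _).trans (Real.exp_le_exp.2 (sq_sub_div_two_le x i j))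
      _ = Real.exp (∑ k, x k ^ 2) := by
          simp only [← Finset.sum_mul, ← Finset.mul_sum, hs.2, mul_one, one_mul]
  have h := (mul_le_mul_of_nonneg_left hJ' hpos.le).trans (hsym.le.trans hle)
  rw [Real.exp_neg, ← div_eq_mul_inv, div_le_iff₀ (Real.exp_pos _), ← Real.exp_add] at h
  rw [add_comm]
  exact (Real.log_le_iff_le_exp hpos).2 h

theorem partFn_add (h : Fin n → ℝ) (j : Fin n) :
    partFn γ C (fun i => u i + h i) j = partFn γ C u j *
      ∑ i, Real.exp ((u i - C j i) / γ) / partFn γ C u j * Real.exp (h i / γ) := by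
  rw [Finset.mul_sum, partFn]
  refine Finset.sum_congr rfl fun i _ => ?_
  have := (partFn_pos (γ := γ) (C := C) (u := u) j).ne'
  rw [add_sub_right_comm, add_div, Real.exp_add]
  field_simp

/-- The gradient of the conjugate is Lipschitz continuous. -/
theorem conjVal_add_le_of_smooth (hγ : 0 < γ) (hp : p ∈ stdSimplex ℝ (Fin n)) (h : Fin n → ℝ) :
    conjVal γ C p (fun i => u i + h i) ≤
      conjVal γ C p u + ∑ i, gradConj γ C p u i * h i + (∑ i, h i ^ 2) / γ := by
  have hs : ∀ j, (fun i => Real.exp ((u i - C j i) / γ) / partFn γ C u j) ∈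
      stdSimplex ℝ (Fin n) := fun j =>
    ⟨fun i => div_nonneg (Real.exp_pos _).le (partFn_pos j).le, sum_softmax j⟩
  -- The shift multiplies each partition function by the softmax average of `exp (h / γ)`. The error
  -- `∑ (h/γ)²` becomes `∑ h² / γ` after multiplication by `γ`.
  have hlog : ∀ j, Real.log (partFn γ C (fun i => u i + h i) j) ≤ Real.log (partFn γ C u j) +
      (∑ i, Real.exp ((u i - C j i) / γ) / partFn γ C u j * (h i / γ) +
        ∑ i, (h i / γ) ^ 2) := by
    intro j
    rw [partFn_add, Real.log_mul (partFn_pos j).ne']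
    · exact add_le_add_right (log_sum_mul_exp_le (hs j) _) _
    · refine (Finset.sum_pos (fun i _ => ?_) ⟨j, Finset.mem_univ j⟩).ne'
      exact mul_pos (div_pos (Real.exp_pos _) (partFn_pos j)) (Real.exp_pos _)
  have e1 : ∑ i, gradConj γ C p u i * h i =
      γ * ∑ j, p j * ∑ i, Real.exp ((u i - C j i) / γ) / partFn γ C u j * (h i / γ) := by
    simp only [gradConj_eq_sum, Finset.mul_sum, Finset.sum_mul]
    rw [Finset.sum_comm]
    refine Finset.sum_congr rfl fun j _ => Finset.sum_congr rfl fun i _ => ?_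
    rw [gibbsPlan]
    field_simp
  have e2 : (∑ i, h i ^ 2) / γ = γ * ∑ j, p j * ∑ i, (h i / γ) ^ 2 := by
    rw [← Finset.sum_mul, hp.2, one_mul, Finset.mul_sum, Finset.sum_div]
    refine Finset.sum_congr rfl fun i _ => ?_
    field_simp
  have hsum : ∑ j, p j * (Real.log (partFn γ C (fun i => u i + h i) j) - Real.log (p j)) ≤
      ∑ j, p j * (Real.log (partFn γ C u j) - Real.log (p j)) +
      (∑ j, p j * ∑ i, Real.exp ((u i - C j i) / γ) / partFn γ C u j * (h i / γ) +
        ∑ j, p j * ∑ i, (h i / γ) ^ 2) := by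
    rw [← Finset.sum_add_distrib, ← Finset.sum_add_distrib]
    refine Finset.sum_le_sum fun j _ => ?_
    rw [← mul_add, ← mul_add]
    refine mul_le_mul_of_nonneg_left ?_ (hp.1 j)
    linarith [hlog j]
  have := mul_le_mul_of_nonneg_left hsum hγ.le
  rw [e1, e2, conjVal, conjVal]
  linarith

end Conjugate

/-! ### Entropy bounds and dependence of the transport cost on the marginals -/

section Transport

variable {n : ℕ} {γ : ℝ} {C : Matrix (Fin n) (Fin n) ℝ} {p p' q : Fin n → ℝ}
  {π : Matrix (Fin n) (Fin n) ℝ}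

theorem sum_sum_of_mem_couplings (hp : p ∈ stdSimplex ℝ (Fin n)) (h : π ∈ couplings p q) :
    ∑ i, ∑ j, π i j = 1 := by
  simp only [h.2.1, hp.2]

theorem negEntropy_eq (hp : p ∈ stdSimplex ℝ (Fin n)) (h : π ∈ couplings p q) :
    negEntropy π = ∑ i, ∑ j, π i j * Real.log (π i j) - 1 := by
  rw [← sum_sum_of_mem_couplings hp h, negEntropy]
  simp only [← Finset.sum_sub_distrib]
  exact Finset.sum_congr rfl fun i _ => Finset.sum_congr rfl fun j _ => by ring

theorem negEntropy_le (hp : p ∈ stdSimplex ℝ (Fin n)) (h : π ∈ couplings p q) :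
    negEntropy π ≤ -1 := by
  rw [negEntropy_eq hp h]
  have : ∑ i, ∑ j, π i j * Real.log (π i j) ≤ 0 := by
    refine Finset.sum_nonpos fun i _ => Finset.sum_nonpos fun j _ => ?_
    refine mul_nonpos_of_nonneg_of_nonpos (h.1 i j) (Real.log_nonpos (h.1 i j) ?_)
    calc π i j ≤ ∑ j, π i j := Finset.single_le_sum (fun j _ => h.1 i j) (Finset.mem_univ j)
      _ = p i := h.2.1 i
      _ ≤ ∑ i, p i := Finset.single_le_sum (fun i _ => hp.1 i) (Finset.mem_univ i)
      _ = 1 := hp.2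
  linarith

/-- Gibbs' inequality against the uniform plan with entries `1 / n²`. -/
theorem le_negEntropy (hp : p ∈ stdSimplex ℝ (Fin n)) (h : π ∈ couplings p q) :
    -(2 * Real.log n) - 1 ≤ negEntropy π := by
  have hn : (n : ℝ) ≠ 0 := by
    rcases Nat.eq_zero_or_pos n with h0 | h0
    · subst h0
      simpa using hp.2
    · exact_mod_cast h0.ne'
  rw [negEntropy_eq hp h]
  have hsum : ∑ i, ∑ j, (π i j * Real.log (1 / (n : ℝ) ^ 2) - π i j * Real.log (π i j)) ≤
      ∑ i, ∑ j, (1 / (n : ℝ) ^ 2 - π i j) :=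
    Finset.sum_le_sum fun i _ => Finset.sum_le_sum fun j _ =>
      mul_log_sub_mul_log_le (h.1 i j) (by positivity)
  have h1 := sum_sum_of_mem_couplings hp h
  simp only [Finset.sum_sub_distrib, ← Finset.sum_mul, h1] at hsum
  simp only [Finset.sum_const, Finset.card_univ, Fintype.card_fin, nsmul_eq_mul] at hsum
  have e : (n : ℝ) * (n * (1 / (n : ℝ) ^ 2)) = 1 := by field_simp
  rw [e, one_div, Real.log_inv, Real.log_pow] at hsum
  push_cast at hsum
  linarith

theorem negEntropy_convex {π' : Matrix (Fin n) (Fin n) ℝ} (h : ∀ i j, 0 ≤ π i j)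
    (h' : ∀ i j, 0 ≤ π' i j) {a b : ℝ} (ha : 0 ≤ a) (hb : 0 ≤ b) (hab : a + b = 1) :
    negEntropy (a • π + b • π') ≤ a * negEntropy π + b * negEntropy π' := by
  simp only [negEntropy, Finset.mul_sum, ← Finset.sum_add_distrib]
  refine Finset.sum_le_sum fun i _ => Finset.sum_le_sum fun j _ => ?_
  have := Real.convexOn_mul_log.2 (Set.mem_Ici.2 (h i j)) (Set.mem_Ici.2 (h' i j)) ha hb hab
  simp only [smul_eq_mul] at this
  simp only [Matrix.add_apply, Matrix.smul_apply, smul_eq_mul]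
  linarith

theorem cost_add_smul (π π' : Matrix (Fin n) (Fin n) ℝ) (a b : ℝ) :
    cost C (a • π + b • π') = a * cost C π + b * cost C π' := by
  simp only [cost, Finset.mul_sum, ← Finset.sum_add_distrib]
  refine Finset.sum_congr rfl fun i _ => Finset.sum_congr rfl fun j _ => ?_
  simp only [Matrix.add_apply, Matrix.smul_apply, smul_eq_mul]
  ring

theorem planValue_convex (hγ : 0 ≤ γ) {π' : Matrix (Fin n) (Fin n) ℝ} (h : ∀ i j, 0 ≤ π i j)
    (h' : ∀ i j, 0 ≤ π' i j) {a b : ℝ} (ha : 0 ≤ a) (hb : 0 ≤ b) (hab : a + b = 1) :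
    planValue γ C (a • π + b • π') ≤ a * planValue γ C π + b * planValue γ C π' := by
  rw [planValue, cost_add_smul, planValue, planValue]
  linarith [mul_le_mul_of_nonneg_left (negEntropy_convex h h' ha hb hab) hγ]

theorem le_maxEntry (i j : Fin n) : C i j ≤ maxEntry C :=
  le_ciSup (f := fun ij : Fin n × Fin n => C ij.1 ij.2) (Set.finite_range _).bddAbove (i, j)

theorem maxEntry_nonneg (hC : ∀ i j, 0 ≤ C i j) : 0 ≤ maxEntry C :=
  Real.iSup_nonneg fun ij => hC ij.1 ij.2

theorem cost_nonneg (hC : ∀ i j, 0 ≤ C i j) (h : ∀ i j, 0 ≤ π i j) : 0 ≤ cost C π :=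
  Finset.sum_nonneg fun i _ => Finset.sum_nonneg fun j _ => mul_nonneg (h i j) (hC i j)

theorem otCost_le (hC : ∀ i j, 0 ≤ C i j) (h : π ∈ couplings p q) : otCost C p q ≤ cost C π := by
  refine csInf_le ⟨0, ?_⟩ ⟨π, h, rfl⟩
  rintro _ ⟨π', h', rfl⟩
  exact cost_nonneg hC h'.1

theorem le_otCost (hp : p ∈ stdSimplex ℝ (Fin n)) (hq : q ∈ stdSimplex ℝ (Fin n)) {c : ℝ}
    (h : ∀ π ∈ couplings p q, c ≤ cost C π) : c ≤ otCost C p q := by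
  refine le_csInf ⟨_, _, product_mem_couplings hp hq, rfl⟩ ?_
  rintro _ ⟨π, hπ, rfl⟩
  exact h π hπ

/-- A plan for `(p', q)` can be turned into one for `(p, q)` by moving the mass in which `p` and
`p'` differ. -/
theorem exists_coupling_cost_le (hC : ∀ i j, 0 ≤ C i j) (hp : p ∈ stdSimplex ℝ (Fin n))
    (hp' : p' ∈ stdSimplex ℝ (Fin n)) (h : π ∈ couplings p' q) :
    ∃ π' ∈ couplings p q, cost C π' ≤ cost C π + maxEntry C / 2 * ∑ i, |p i - p' i| := by
  -- Row `j` keeps the fraction `r j` of its mass. The missing row masses `a` and column masses `b`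
  -- have the common total `δ = ‖p - p'‖₁ / 2` and are joined by the product plan `a b / δ`.
  set r : Fin n → ℝ := fun j => min (p j) (p' j) / p' j with hr
  have hr0 : ∀ j, 0 ≤ r j := fun j => div_nonneg (le_min (hp.1 j) (hp'.1 j)) (hp'.1 j)
  have hr1 : ∀ j, r j ≤ 1 := fun j => div_le_one_of_le₀ (min_le_right _ _) (hp'.1 j)
  have hrp : ∀ j, r j * p' j = min (p j) (p' j) := by
    intro j
    rcases eq_or_ne (p' j) 0 with h0 | h0
    · rw [h0, mul_zero, min_eq_right (hp.1 j)]
    · exact div_mul_cancel₀ _ h0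
  set a : Fin n → ℝ := fun j => p j - min (p j) (p' j) with ha
  have ha0 : ∀ j, 0 ≤ a j := fun j => sub_nonneg.2 (min_le_left _ _)
  set b : Fin n → ℝ := fun i => q i - ∑ j, r j * π j i with hb
  have hb0 : ∀ i, 0 ≤ b i := by
    intro i
    rw [hb, sub_nonneg, ← h.2.2 i]
    exact Finset.sum_le_sum fun j _ => mul_le_of_le_one_left (h.1 j i) (hr1 j)
  set δ : ℝ := ∑ j, a j with hδ
  have hδb : ∑ i, b i = δ := by
    rw [hb, hδ, ha, Finset.sum_sub_distrib, Finset.sum_sub_distrib, Finset.sum_comm,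
      sum_of_mem_couplings h, hp'.2, hp.2]
    simp only [← Finset.mul_sum, h.2.1, hrp]
  have hδ2 : ∑ i, |p i - p' i| = 2 * δ := by
    have e : ∀ i, |p i - p' i| = 2 * a i - (p i - p' i) := by
      intro i
      rcases le_total (p i) (p' i) with hi | hi
      · simp only [ha, min_eq_left hi, abs_of_nonpos (sub_nonpos.2 hi)]
        ring
      · simp only [ha, min_eq_right hi, abs_of_nonneg (sub_nonneg.2 hi)]
        ring
    simp only [e, Finset.sum_sub_distrib, ← Finset.mul_sum, hp.2, hp'.2]
    ring
  have hδ0 : 0 ≤ δ := Finset.sum_nonneg fun j _ => ha0 j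
  have hab : ∀ j, ∑ i, a j * b i / δ = a j := by
    intro j
    rw [← Finset.sum_div, ← Finset.mul_sum, hδb]
    -- If `δ = 0`, the quotient is `0` by convention, which is right because then `a = 0`.
    rcases hδ0.eq_or_lt with h0 | h0
    · rw [← h0, div_zero]
      exact ((Finset.sum_eq_zero_iff_of_nonneg fun j _ => ha0 j).1 h0.symm j
        (Finset.mem_univ j)).symm
    · exact mul_div_cancel_right₀ _ h0.ne'
  have hab' : ∀ i, ∑ j, a j * b i / δ = b i := by
    intro i
    rw [← Finset.sum_div, ← Finset.sum_mul, ← hδ]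
    rcases hδ0.eq_or_lt with h0 | h0
    · rw [← h0, div_zero]
      exact ((Finset.sum_eq_zero_iff_of_nonneg fun i _ => hb0 i).1 (hδb.trans h0.symm) i
        (Finset.mem_univ i)).symm
    · exact mul_div_cancel_left₀ _ h0.ne'
  have hab0 : ∀ j i, 0 ≤ a j * b i / δ := fun j i => div_nonneg (mul_nonneg (ha0 j) (hb0 i)) hδ0
  refine ⟨fun j i => r j * π j i + a j * b i / δ, ⟨fun j i => ?_, fun j => ?_, fun i => ?_⟩, ?_⟩
  · exact add_nonneg (mul_nonneg (hr0 j) (h.1 j i)) (hab0 j i)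
  · rw [Finset.sum_add_distrib, ← Finset.mul_sum, h.2.1, hrp, hab]
    exact add_sub_cancel _ _
  · rw [Finset.sum_add_distrib, hab']
    exact add_sub_cancel _ _
  · calc cost C (fun j i => r j * π j i + a j * b i / δ)
        ≤ ∑ j, ∑ i, (π j i * C j i + maxEntry C * (a j * b i / δ)) := by
          refine Finset.sum_le_sum fun j _ => Finset.sum_le_sum fun i _ => ?_
          have h1 : r j * π j i * C j i ≤ π j i * C j i :=
            mul_le_mul_of_nonneg_right (mul_le_of_le_one_left (h.1 j i) (hr1 j)) (hC j i)
          have h2 := mul_le_mul_of_nonneg_left (le_maxEntry (C := C) j i) (hab0 j i)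
          linarith
      _ = cost C π + maxEntry C / 2 * ∑ i, |p i - p' i| := by
          simp only [Finset.sum_add_distrib, ← Finset.mul_sum, hab]
          rw [hδ2, cost]
          ring

theorem otCost_le_add (hC : ∀ i j, 0 ≤ C i j) (hp : p ∈ stdSimplex ℝ (Fin n))
    (hp' : p' ∈ stdSimplex ℝ (Fin n)) (hq : q ∈ stdSimplex ℝ (Fin n)) :
    otCost C p q ≤ otCost C p' q + maxEntry C / 2 * ∑ i, |p i - p' i| := by
  rw [← sub_le_iff_le_add]
  refine le_otCost hp' hq fun π hπ => ?_
  obtain ⟨π', hπ', hle⟩ := exists_coupling_cost_le hC hp hp' hπ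
  linarith [otCost_le hC hπ']

end Transport

/-! ### The accelerated gradient method -/

section StepSize

variable {L A : ℝ}

theorem stepSize_pos (hL : 0 < L) (A : ℝ) : 0 < stepSize L A := by
  have := Real.sqrt_nonneg (1 + 8 * L * A)
  unfold stepSize
  positivity

theorem add_stepSize (hL : 0 < L) (hA : 0 ≤ A) : A + stepSize L A = 2 * L * stepSize L A ^ 2 :=
  (isGreatest_stepSize hL hA).1

/-- The root satisfies `4 L α = 1 + √(1 + 8 L A) ≥ 1 + k`, and `8 L (A + α) = (4 L α)²`. So `√(8 L
A)` grows by at least `1` per iteration. -/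
theorem le_add_stepSize (hL : 0 < L) (hA : 0 ≤ A) {k : ℝ} (hk : 0 ≤ k)
    (h : k ^ 2 ≤ 8 * L * A) : (k + 1) ^ 2 ≤ 8 * L * (A + stepSize L A) := by
  have h1 : 4 * L * stepSize L A = 1 + √(1 + 8 * L * A) := by
    rw [stepSize]
    field_simp
  have h2 : k ≤ √(1 + 8 * L * A) := Real.le_sqrt_of_sq_le (by linarith)
  have h3 : 8 * L * (A + stepSize L A) = (4 * L * stepSize L A) ^ 2 := by
    rw [add_stepSize hL hA]
    ring
  rw [h3, h1]
  exact pow_le_pow_left₀ (by linarith) (by linarith) 2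

end StepSize

/-- One step of the method of similar triangles, started at the origin. -/
theorem accelerated_step {ι : Type*} [Fintype ι] {L A α b φx φy φy' : ℝ} {x y z g y' : ι → ℝ}
    (hA : 0 ≤ A) (hα : 0 < α) (hAα : A + α = 2 * L * α ^ 2)
    (hx : (A + α) • x = α • z + A • y) (hy' : (A + α) • y' = α • (z - α • g) + A • y)
    (hconv : φx + g ⬝ᵥ (y - x) ≤ φy)
    (hsmooth : φy' ≤ φx + g ⬝ᵥ (y' - x) + L * ((y' - x) ⬝ᵥ (y' - x)))
    (hind : A * φy ≤ b - (z ⬝ᵥ z) / 2) :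
    (A + α) * φy' ≤ b + α * (φx - g ⬝ᵥ x) - ((z - α • g) ⬝ᵥ (z - α • g)) / 2 := by
  have hA' : 0 < A + α := by linarith
  -- The averages `x` and `y'` differ only through `z` and `z - α g`.
  have hd : (A + α) • (y' - x) = -(α ^ 2) • g := by
    rw [smul_sub, hx, hy']
    module
  have hd' : y' - x = (-(α ^ 2) / (A + α)) • g := by
    rw [div_eq_inv_mul, mul_smul, ← hd, smul_smul, inv_mul_cancel₀ hA'.ne', one_smul]
  have hX : (A + α) * (g ⬝ᵥ x) = α * (g ⬝ᵥ z) + A * (g ⬝ᵥ y) := by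
    have := congrArg (fun v => g ⬝ᵥ v) hx
    simpa using this
  have e1 : (A + α) * (g ⬝ᵥ (y' - x)) = -(α ^ 2) * (g ⬝ᵥ g) := by
    rw [hd', dotProduct_smul, smul_eq_mul]
    field_simp
  -- The equation for `α` is chosen for this: the smoothness error is exactly half of the gain `α²
  -- ‖g‖²` from `e1`, and the other half pays for the term `α² ‖g‖² / 2` in `‖z - α g‖² / 2`.
  have e2 : (A + α) * (L * ((y' - x) ⬝ᵥ (y' - x))) = α ^ 2 / 2 * (g ⬝ᵥ g) := by
    rw [hd', dotProduct_smul, smul_dotProduct, smul_eq_mul, smul_eq_mul]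
    have : α ≠ 0 := hα.ne'
    have hL : L * (α ^ 2) = (A + α) / 2 := by linarith
    calc (A + α) * (L * (-(α ^ 2) / (A + α) * (-(α ^ 2) / (A + α) * (g ⬝ᵥ g))))
        = (L * α ^ 2) * α ^ 2 / (A + α) * (g ⬝ᵥ g) := by field_simp
      _ = α ^ 2 / 2 * (g ⬝ᵥ g) := by
        rw [hL]
        field_simp
  have e3 : (z - α • g) ⬝ᵥ (z - α • g) = z ⬝ᵥ z - 2 * α * (g ⬝ᵥ z) + α ^ 2 * (g ⬝ᵥ g) := by
    simp only [sub_dotProduct, dotProduct_sub, smul_dotProduct, dotProduct_smul, smul_eq_mul]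
    rw [dotProduct_comm z g]
    ring
  rw [dotProduct_sub] at hconv
  have h1 := mul_le_mul_of_nonneg_left hsmooth hA'.le
  have h2 := mul_le_mul_of_nonneg_left hconv hA
  rw [e3]
  linarith

/-! ### The primal-dual invariant of the iterates -/

section Method

variable {m n : ℕ} {d : Input m n}

/-- The hypotheses on the input under which the method converges. -/
structure Input.Valid (d : Input m n) : Prop where
  m_pos : 0 < m
  two_le_n : 2 ≤ n
  eps_pos : 0 < d.ε
  w_pos : ∀ l, 0 < d.w l
  p_mem : ∀ l, d.p l ∈ stdSimplex ℝ (Fin n)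
  posSemidef : d.Wbar.PosSemidef
  L_eq : d.L = lipConst n d.ε d.Wbar
  L_pos : 0 < d.L

/-- The regularization parameter `γ(l)` of the agent `l`. -/
def Input.reg (d : Input m n) (l : Fin m) : ℝ := gam n d.ε d.w l

/-- The dual objective as a function of `λ_l = [√W u]_l / w_l`. -/
def Input.sepObj (d : Input m n) (v : Fin m → Fin n → ℝ) : ℝ :=
  ∑ l, d.w l * conjVal (d.reg l) (d.C l) (d.p l) (v l)

/-- The weighted sum of the regularized transport objectives. -/
def Input.planObj (d : Input m n) (π : Fin m → Matrix (Fin n) (Fin n) ℝ) : ℝ :=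
  ∑ l, d.w l * planValue (d.reg l) (d.C l) (π l)

/-- The gradients of the agents. -/
def Input.grads (d : Input m n) (v : Fin m → Fin n → ℝ) : Fin m → Fin n → ℝ :=
  fun l => gradConj (d.reg l) (d.C l) (d.p l) (v l)

/-- The Gibbs plans of the agents. -/
def Input.plans (d : Input m n) (v : Fin m → Fin n → ℝ) : Fin m → Matrix (Fin n) (Fin n) ℝ :=
  fun l => gibbsPlan (d.reg l) (d.C l) (d.p l) (v l)

/-- `u` is mapped to `v` by the substitution `λ_l = [√W u]_l / w_l`. -/
def Input.Lifts (d : Input m n) (u : Fin m × Fin n → ℝ) (v : Fin m → Fin n → ℝ) : Prop :=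
  ∀ l i, (sqrtW n d.Wbar *ᵥ u) (l, i) = d.w l * v l i

namespace Input.Valid

theorem log_pos (hd : d.Valid) : 0 < Real.log n :=
  Real.log_pos (by exact_mod_cast hd.two_le_n)

theorem reg_pos (hd : d.Valid) (l : Fin m) : 0 < d.reg l := by
  have h1 : (0 : ℝ) < m := by exact_mod_cast hd.m_pos
  have := hd.eps_pos
  have := hd.w_pos l
  have := hd.log_pos
  unfold Input.reg gam
  positivity

/-- The product does not depend on `l`. This lets `L` contain no weights, and makes the entropies of
all agents enter `planObj` with one coefficient. -/
theorem w_mul_reg (hd : d.Valid) (l : Fin m) :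
    d.w l * d.reg l = d.ε / (4 * m * Real.log n) := by
  have h1 : (0 : ℝ) < m := by exact_mod_cast hd.m_pos
  have := hd.w_pos l
  have := hd.log_pos
  unfold Input.reg gam
  field_simp

theorem sepObj_add_le (hd : d.Valid) (x y : Fin m → Fin n → ℝ) :
    d.sepObj x + ∑ l, d.w l * ∑ i, d.grads x l i * (y l i - x l i) ≤ d.sepObj y := by
  rw [Input.sepObj, ← Finset.sum_add_distrib]
  refine Finset.sum_le_sum fun l _ => ?_
  rw [← mul_add]
  exact mul_le_mul_of_nonneg_left (conjVal_add_le (hd.reg_pos l) (hd.p_mem l) (y l)) (hd.w_pos l).le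

theorem sepObj_le (hd : d.Valid) (x y : Fin m → Fin n → ℝ) :
    d.sepObj y ≤ d.sepObj x + ∑ l, d.w l * ∑ i, d.grads x l i * (y l i - x l i) +
      ∑ l, d.w l * ((∑ i, (y l i - x l i) ^ 2) / d.reg l) := by
  simp only [Input.sepObj]
  rw [← Finset.sum_add_distrib, ← Finset.sum_add_distrib]
  refine Finset.sum_le_sum fun l _ => ?_
  rw [← mul_add, ← mul_add]
  refine mul_le_mul_of_nonneg_left ?_ (hd.w_pos l).le
  have := conjVal_add_le_of_smooth (C := d.C l) (u := x l) (hd.reg_pos l) (hd.p_mem l)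
    (fun i => y l i - x l i)
  simp only [add_sub_cancel] at this
  exact this

/-- Minus the constant term of the linearization at `x` is a primal value; this turns the dual
method into a primal-dual one. -/
theorem planObj_plans (hd : d.Valid) (x : Fin m → Fin n → ℝ) :
    d.planObj (d.plans x) = ∑ l, d.w l * ∑ i, d.grads x l i * x l i - d.sepObj x := by
  rw [Input.planObj, Input.sepObj, ← Finset.sum_sub_distrib]
  refine Finset.sum_congr rfl fun l _ => ?_
  rw [Input.plans, planValue_gibbsPlan (hd.reg_pos l) (hd.p_mem l), mul_sub]
  simp only [mul_comm (x l _)]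
  rfl

/-- Weak duality. -/
theorem neg_sepObj_le (hd : d.Valid) {π : Fin m → Matrix (Fin n) (Fin n) ℝ}
    {q : Fin m → Fin n → ℝ} (hπ : ∀ l, π l ∈ couplings (d.p l) (q l)) (x : Fin m → Fin n → ℝ) :
    ∑ l, d.w l * ∑ i, q l i * x l i ≤ d.planObj π + d.sepObj x := by
  rw [Input.planObj, Input.sepObj, ← Finset.sum_add_distrib]
  refine Finset.sum_le_sum fun l _ => ?_
  rw [← mul_add]
  refine mul_le_mul_of_nonneg_left ?_ (hd.w_pos l).le
  have := sum_mul_sub_planValue_le (C := d.C l) (u := x l) (hd.reg_pos l) (hd.p_mem l) (hπ l)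
  simp only [mul_comm (x l _)] at this
  linarith

end Input.Valid

theorem Input.Lifts.dotProduct_stack {u : Fin m × Fin n → ℝ} {v : Fin m → Fin n → ℝ}
    (h : d.Lifts u v) (g : Fin m → Fin n → ℝ) :
    (sqrtW n d.Wbar *ᵥ stack g) ⬝ᵥ u = ∑ l, d.w l * ∑ i, g l i * v l i := by
  rw [sqrtW_mulVec_dotProduct, dotProduct, Fintype.sum_prod_type]
  refine Finset.sum_congr rfl fun l _ => ?_
  rw [Finset.mul_sum]
  refine Finset.sum_congr rfl fun i _ => ?_
  rw [h l i, stack]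
  ring

theorem Input.Lifts.sub {u u' : Fin m × Fin n → ℝ} {v v' : Fin m → Fin n → ℝ}
    (h : d.Lifts u v) (h' : d.Lifts u' v') :
    d.Lifts (u - u') (fun l i => v l i - v' l i) := by
  intro l i
  rw [mulVec_sub, Pi.sub_apply, h, h', mul_sub]

theorem Input.Lifts.combine {u u' : Fin m × Fin n → ℝ} {v v' : Fin m → Fin n → ℝ}
    (h : d.Lifts u v) (h' : d.Lifts u' v') (a b c : ℝ) :
    d.Lifts (c⁻¹ • (a • u + b • u')) (fun l i => (a * v l i + b * v' l i) / c) := by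
  intro l i
  simp only [mulVec_smul, mulVec_add, Pi.smul_apply, Pi.add_apply, smul_eq_mul, h l i, h' l i]
  rw [div_eq_inv_mul]
  ring

/-- With `v_l = [√W u]_l / w_l` and `w_l γ(l) = γ`, the left side is `⟨u, W u⟩ / γ`. -/
theorem Input.Valid.sum_sq_div_reg_le (hd : d.Valid) {u : Fin m × Fin n → ℝ}
    {v : Fin m → Fin n → ℝ} (h : d.Lifts u v) :
    ∑ l, d.w l * ((∑ i, v l i ^ 2) / d.reg l) ≤ d.L * (u ⬝ᵥ u) := by
  have h1 : (0 : ℝ) < m := by exact_mod_cast hd.m_pos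
  have h2 := hd.log_pos
  have h3 := hd.eps_pos
  set c : ℝ := d.ε / (4 * m * Real.log n) with hc
  have hc0 : 0 < c := by positivity
  have e : ∑ l, d.w l * ((∑ i, v l i ^ 2) / d.reg l) =
      ((sqrtW n d.Wbar *ᵥ u) ⬝ᵥ (sqrtW n d.Wbar *ᵥ u)) / c := by
    rw [dotProduct, Fintype.sum_prod_type, Finset.sum_div]
    refine Finset.sum_congr rfl fun l _ => ?_
    rw [hc, ← hd.w_mul_reg l]
    simp only [h l]
    have := hd.w_pos l
    have := hd.reg_pos l
    rw [Finset.sum_div, Finset.sum_div, Finset.mul_sum]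
    refine Finset.sum_congr rfl fun i _ => ?_
    field_simp
  rw [e, sqrtW_mulVec_dotProduct_self hd.posSemidef, hd.L_eq, lipConst, ← hc, div_mul_eq_mul_div]
  exact div_le_div_of_nonneg_right (dotProduct_mulVec_le_lamMax (posSemidef_bigW hd.posSemidef) u)
    hc0.le

/-- The gradient in `u` is `√W g`. Mapping a step along it by `√W` again produces `W g`, so the
agents need only `W̄`. -/
theorem Input.Valid.lifts_step (hd : d.Valid) {z : Fin m × Fin n → ℝ} {v : Fin m → Fin n → ℝ}
    (h : d.Lifts z v) (g : Fin m → Fin n → ℝ) (α : ℝ) :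
    d.Lifts (z - α • (sqrtW n d.Wbar *ᵥ stack g))
      (fun l i => v l i - α / d.w l * ∑ j, d.Wbar l j * g j i) := by
  intro l i
  have := (hd.w_pos l).ne'
  rw [mulVec_sub, mulVec_smul, mulVec_mulVec, sqrtW_mul_sqrtW hd.posSemidef, Pi.sub_apply,
    Pi.smul_apply, bigW_mulVec, h, smul_eq_mul]
  simp only [stack]
  field_simp

/-- What is known about the state `s`: `z` and `y` are the dual iterates whose images are `zeta`
and `eta`, and the plans `π` have the column sums `q`. -/
structure Certificate (d : Input m n) (s : State m n) (z y : Fin m × Fin n → ℝ)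
    (π : Fin m → Matrix (Fin n) (Fin n) ℝ) : Prop where
  A_nonneg : 0 ≤ s.A
  zeta : d.Lifts z s.zeta
  eta : d.Lifts y s.eta
  z_eq : z = -s.A • (sqrtW n d.Wbar *ᵥ stack s.q)
  nonneg : ∀ l j i, 0 ≤ π l j i
  row : ∀ l j, s.A * ∑ i, π l j i = s.A * d.p l j
  col : ∀ l i, s.A * ∑ j, π l j i = s.A * s.q l i
  bound : s.A * (d.sepObj s.eta + d.planObj π) ≤ -(z ⬝ᵥ z) / 2

theorem Input.Valid.exists_certificate_iterate (hd : d.Valid) {s : State m n}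
    {z y : Fin m × Fin n → ℝ} {π : Fin m → Matrix (Fin n) (Fin n) ℝ}
    (h : Certificate d s z y π) : ∃ z' y' π', Certificate d (iterate d s) z' y' π' := by
  have hα := stepSize_pos hd.L_pos s.A
  have hA := h.A_nonneg
  have hAα := add_stepSize hd.L_pos hA
  set α := stepSize d.L s.A with hαdef
  set A := s.A with hAdef
  have hA' : 0 < A + α := by linarith
  set x : Fin m → Fin n → ℝ := fun l i => (α * s.zeta l i + A * s.eta l i) / (A + α) with hx
  set g := d.grads x with hg
  set G := sqrtW n d.Wbar *ᵥ stack g with hG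
  set z' := z - α • G with hz'
  set ux := (A + α)⁻¹ • (α • z + A • y) with hux
  set y' := (A + α)⁻¹ • (α • z' + A • y) with hy'
  -- The plans are averaged with the weights used for `q`, so their column sums remain `q`.
  set π' : Fin m → Matrix (Fin n) (Fin n) ℝ :=
    fun l => (α / (A + α)) • d.plans x l + (A / (A + α)) • π l with hπ'
  have lx : d.Lifts ux x := h.zeta.combine h.eta α A (A + α)
  have lz' : d.Lifts z' (iterate d s).zeta := hd.lifts_step h.zeta g α
  have ly' : d.Lifts y' (iterate d s).eta := lz'.combine h.eta α A (A + α)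
  have hmem : ∀ l, d.plans x l ∈ couplings (d.p l) (g l) := fun l => gibbsPlan_mem (hd.p_mem l)
  have eA : (iterate d s).A = A + α := rfl
  have eq : (iterate d s).q = fun l i => (α * g l i + A * s.q l i) / (A + α) := rfl
  have hconvπ : (A + α) * d.planObj π' ≤ α * d.planObj (d.plans x) + A * d.planObj π := by
    simp only [Input.planObj, Finset.mul_sum, ← Finset.sum_add_distrib]
    refine Finset.sum_le_sum fun l _ => ?_
    have := planValue_convex (C := d.C l) (hd.reg_pos l).le (hmem l).1 (h.nonneg l)
      (a := α / (A + α)) (b := A / (A + α)) (by positivity) (by positivity) (by field_simp; ring)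
    have := mul_le_mul_of_nonneg_left this (mul_pos hA' (hd.w_pos l)).le
    calc _ = (A + α) * d.w l * planValue (d.reg l) (d.C l) (π' l) := by ring
      _ ≤ _ := this
      _ = _ := by field_simp
  have hstep := accelerated_step (φx := d.sepObj x) (φy := d.sepObj s.eta)
    (φy' := d.sepObj (iterate d s).eta) (b := -(A * d.planObj π)) (g := G) (x := ux) (y := y)
    (z := z) (y' := y') hA hα hAα (by rw [hux, smul_inv_smul₀ hA'.ne'])
    (by rw [hy', smul_inv_smul₀ hA'.ne']) ?_ ?_ ?_
  · refine ⟨z', y', π', hA'.le, lz', ly', ?_, ?_, ?_, ?_, ?_⟩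
    · have : (A + α) • stack (iterate d s).q = α • stack g + A • stack s.q := by
        ext ⟨l, i⟩
        simp only [eq, stack, Pi.smul_apply, Pi.add_apply, smul_eq_mul]
        field_simp
      rw [eA, neg_smul, ← mulVec_smul, this, mulVec_add, mulVec_smul, mulVec_smul, hz', h.z_eq, hG]
      module
    · intro l j i
      exact add_nonneg (mul_nonneg (by positivity) ((hmem l).1 j i))
        (mul_nonneg (by positivity) (h.nonneg l j i))
    · intro l j
      have h1 := (hmem l).2.1 j
      have h2 := h.row l j
      simp only [hπ', Matrix.add_apply, Matrix.smul_apply, smul_eq_mul, Finset.sum_add_distrib,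
        ← Finset.mul_sum, h1, eA]
      field_simp
      linarith
    · intro l i
      have h1 := (hmem l).2.2 i
      have h2 := h.col l i
      simp only [hπ', Matrix.add_apply, Matrix.smul_apply, smul_eq_mul, Finset.sum_add_distrib,
        ← Finset.mul_sum, h1, eA, eq]
      field_simp
      linarith
    · rw [lx.dotProduct_stack] at hstep
      have := hd.planObj_plans x
      rw [eA]
      -- The increment of the bound is minus a primal value, which `hconvπ` merges with `-(A *
      -- d.planObj π)`.
      have e : α * (d.sepObj x - ∑ l, d.w l * ∑ i, g l i * x l i) =
          -(α * d.planObj (d.plans x)) := by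
        rw [this]
        ring
      rw [e] at hstep
      linarith
  · rw [(h.eta.sub lx).dotProduct_stack]
    exact hd.sepObj_add_le x s.eta
  · rw [(ly'.sub lx).dotProduct_stack]
    have h1 := hd.sepObj_le x (iterate d s).eta
    have h2 := hd.sum_sq_div_reg_le (ly'.sub lx)
    linarith
  · have := h.bound
    linarith

theorem Input.Valid.exists_certificate_run (hd : d.Valid) (k : ℕ) :
    ∃ z y π, Certificate d (run d k) z y π := by
  induction k with
  | zero =>
    -- The marginal conditions carry the factor `A`, which is `0` here, so the zero matrices may
    -- serve as initial plans although they are not couplings.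
    refine ⟨0, 0, 0, le_rfl, ?_, ?_, ?_, ?_, ?_, ?_, ?_⟩
    · intro l i
      simp [run]
    · intro l i
      simp [run]
    all_goals simp [run]
  | succ k ih =>
    obtain ⟨z, y, π, h⟩ := ih
    exact hd.exists_certificate_iterate h

theorem Input.Valid.sq_le_run_A (hd : d.Valid) (k : ℕ) :
    (k : ℝ) ^ 2 ≤ 8 * d.L * (run d k).A := by
  induction k with
  | zero => simp [run]
  | succ k ih =>
    obtain ⟨z, y, π, h⟩ := hd.exists_certificate_run k
    have := le_add_stepSize hd.L_pos h.A_nonneg (Nat.cast_nonneg k) ih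
    push_cast
    exact this

theorem Input.Valid.run_A_pos (hd : d.Valid) {k : ℕ} (hk : 1 ≤ k) : 0 < (run d k).A := by
  have h := hd.sq_le_run_A k
  have h1 : (0 : ℝ) < (k : ℝ) ^ 2 := by positivity
  exact pos_of_mul_pos_right (h1.trans_le h) (by linarith [hd.L_pos])

end Method

/-! ### A bounded solution of the dual problem -/

section DualSolution

variable {m n : ℕ} {d : Input m n}

/-- The sums `∑_j p_j exp(-C_ji / γ) / Z_j`, where `Z_j` are the normalizing constants at `u`. -/
def colScale (γ : ℝ) (C : Matrix (Fin n) (Fin n) ℝ) (p u : Fin n → ℝ) (i : Fin n) : ℝ :=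
  ∑ j, p j / partFn γ C u j * Real.exp (-C j i / γ)

/-- The sum `∑_j p_j / Z_j`. -/
def massScale (γ : ℝ) (C : Matrix (Fin n) (Fin n) ℝ) (p u : Fin n → ℝ) : ℝ :=
  ∑ j, p j / partFn γ C u j

theorem massScale_pos {γ : ℝ} {C : Matrix (Fin n) (Fin n) ℝ} {p u : Fin n → ℝ}
    (hp : p ∈ stdSimplex ℝ (Fin n)) : 0 < massScale γ C p u := by
  have h0 : ∀ j, 0 ≤ p j / partFn γ C u j := fun j => div_nonneg (hp.1 j) (partFn_pos j).le
  refine lt_of_le_of_ne (Finset.sum_nonneg fun j _ => h0 j) fun h => ?_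
  have hz := (Finset.sum_eq_zero_iff_of_nonneg fun j _ => h0 j).1 h.symm
  have : ∑ j, p j = 0 := Finset.sum_eq_zero fun j hj =>
    (div_eq_zero_iff.1 (hz j hj)).resolve_right (partFn_pos j).ne'
  rw [hp.2] at this
  exact one_ne_zero this

theorem colScale_le {γ : ℝ} {C : Matrix (Fin n) (Fin n) ℝ} {p u : Fin n → ℝ} (hγ : 0 < γ)
    (hp : p ∈ stdSimplex ℝ (Fin n)) (hC : ∀ i j, 0 ≤ C i j) (i : Fin n) :
    colScale γ C p u i ≤ massScale γ C p u := by
  refine Finset.sum_le_sum fun j _ => mul_le_of_le_one_right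
    (div_nonneg (hp.1 j) (partFn_pos j).le) (Real.exp_le_one_iff.2 ?_)
  exact div_nonpos_of_nonpos_of_nonneg (neg_nonpos.2 (hC j i)) hγ.le

/-- Together with `colScale_le`, this confines the logarithms of the column scalings of one agent to
an interval of length `‖C‖_∞ / γ`, whatever `u` is. -/
theorem le_colScale {γ : ℝ} {C : Matrix (Fin n) (Fin n) ℝ} {p u : Fin n → ℝ} (hγ : 0 < γ)
    (hp : p ∈ stdSimplex ℝ (Fin n)) (i : Fin n) :
    massScale γ C p u * Real.exp (-maxEntry C / γ) ≤ colScale γ C p u i := by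
  rw [massScale, Finset.sum_mul]
  refine Finset.sum_le_sum fun j _ => mul_le_mul_of_nonneg_left ?_
    (div_nonneg (hp.1 j) (partFn_pos j).le)
  exact Real.exp_le_exp.2 (div_le_div_of_nonneg_right (neg_le_neg (le_maxEntry j i)) hγ.le)

theorem colScale_pos {γ : ℝ} {C : Matrix (Fin n) (Fin n) ℝ} {p u : Fin n → ℝ} (hγ : 0 < γ)
    (hp : p ∈ stdSimplex ℝ (Fin n)) (i : Fin n) : 0 < colScale γ C p u i :=
  (mul_pos (massScale_pos hp) (Real.exp_pos _)).trans_le (le_colScale hγ hp i)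

theorem sum_exp_mul_colScale {γ : ℝ} {C : Matrix (Fin n) (Fin n) ℝ} {p u : Fin n → ℝ}
    (x : Fin n → ℝ) :
    ∑ i, Real.exp (x i / γ) * colScale γ C p u i =
      ∑ j, p j * (partFn γ C x j / partFn γ C u j) := by
  simp only [colScale, Finset.mul_sum]
  rw [Finset.sum_comm]
  refine Finset.sum_congr rfl fun j _ => ?_
  rw [show partFn γ C x j = ∑ i, Real.exp ((x i - C j i) / γ) from rfl, Finset.sum_div,
    Finset.mul_sum]
  refine Finset.sum_congr rfl fun i _ => ?_
  rw [sub_eq_add_neg, add_div, Real.exp_add]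
  ring

/-- A majorant at `u` that separates over the coordinates of `x`, from `log s ≤ s - 1` applied to
the ratios of partition functions. The parameter `t` absorbs constant shifts of `x`. -/
theorem conjVal_le_add {γ : ℝ} {C : Matrix (Fin n) (Fin n) ℝ} {p u : Fin n → ℝ} (hγ : 0 < γ)
    (hp : p ∈ stdSimplex ℝ (Fin n)) (x : Fin n → ℝ) (t : ℝ) :
    conjVal γ C p x ≤ conjVal γ C p u +
      γ * (Real.exp (-t) * ∑ i, Real.exp (x i / γ) * colScale γ C p u i - 1 + t) := by
  have hj : ∀ j, Real.log (partFn γ C x j) ≤ Real.log (partFn γ C u j) +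
      (Real.exp (-t) * (partFn γ C x j / partFn γ C u j) - 1 + t) := by
    intro j
    have hx := partFn_pos (γ := γ) (C := C) (u := x) j
    have hu := partFn_pos (γ := γ) (C := C) (u := u) j
    have h := Real.log_le_sub_one_of_pos (mul_pos (Real.exp_pos (-t)) (div_pos hx hu))
    rw [Real.log_mul (Real.exp_pos _).ne' (div_pos hx hu).ne', Real.log_exp,
      Real.log_div hx.ne' hu.ne'] at h
    linarith
  have hs : ∑ j, p j * (Real.log (partFn γ C x j) - Real.log (p j)) ≤
      ∑ j, (p j * (Real.log (partFn γ C u j) - Real.log (p j)) +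
        (Real.exp (-t) * (p j * (partFn γ C x j / partFn γ C u j)) - p j + p j * t)) := by
    refine Finset.sum_le_sum fun j _ => ?_
    have := mul_le_mul_of_nonneg_left (hj j) (hp.1 j)
    linarith
  rw [Finset.sum_add_distrib, Finset.sum_add_distrib, Finset.sum_sub_distrib, ← Finset.mul_sum,
    ← Finset.sum_mul, hp.2, one_mul, ← sum_exp_mul_colScale] at hs
  have := mul_le_mul_of_nonneg_left hs hγ.le
  rw [conjVal, conjVal]
  linarith

/-- The logarithms of the column scalings, shifted by `e`. -/
def Input.logScale (d : Input m n) (v : Fin m → Fin n → ℝ) (e : Fin m → ℝ) (l : Fin m)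
    (i : Fin n) : ℝ :=
  Real.log (colScale (d.reg l) (d.C l) (d.p l) (v l) i) - e l

/-- The minimizer of the dual objective for fixed row scalings. -/
def Input.improve (d : Input m n) (v : Fin m → Fin n → ℝ) (e : Fin m → ℝ) (l : Fin m)
    (i : Fin n) : ℝ :=
  d.reg l * ((∑ k, d.logScale v e k i) / m - d.logScale v e l i)

theorem Input.Valid.sum_improve (hd : d.Valid) (v : Fin m → Fin n → ℝ) (e : Fin m → ℝ)
    (i : Fin n) : ∑ l, d.w l * d.improve v e l i = 0 := by
  have hm : (m : ℝ) ≠ 0 := by exact_mod_cast hd.m_pos.ne'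
  simp only [Input.improve, ← mul_assoc, hd.w_mul_reg]
  rw [← Finset.mul_sum, Finset.sum_sub_distrib]
  simp only [Finset.sum_const, Finset.card_univ, Fintype.card_fin, nsmul_eq_mul]
  rw [mul_div_cancel₀ _ hm, sub_self, mul_zero]

/-- At `improve` the majorants involve only the geometric means `Q i` of the column scalings. By
AM-GM and the constraint on `v` these are at most the corresponding arithmetic means at `v`, whose
sum over `i` is `1`. -/
theorem Input.Valid.sepObj_improve_le (hd : d.Valid) {v : Fin m → Fin n → ℝ}
    (hv : ∀ i, ∑ l, d.w l * v l i = 0) (e : Fin m → ℝ) :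
    d.sepObj (d.improve v e) ≤ d.sepObj v := by
  have hm0 : (0 : ℝ) < m := by exact_mod_cast hd.m_pos
  set B : Fin m → Fin n → ℝ := fun l => colScale (d.reg l) (d.C l) (d.p l) (v l) with hB
  have hBpos : ∀ l i, 0 < B l i := fun l i => colScale_pos (hd.reg_pos l) (hd.p_mem l) i
  set c : ℝ := d.ε / (4 * m * Real.log n) with hc
  have hc0 : 0 < c := by
    have := hd.eps_pos
    have := hd.log_pos
    positivity
  -- The effect of the shifts `e`, centred so that the total over the agents is zero.
  set t : Fin m → ℝ := fun l => e l - (∑ k, e k) / m with ht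
  set Q : Fin n → ℝ := fun i => Real.exp ((∑ k, Real.log (B k i)) / m) with hQ
  have ht0 : ∑ l, t l = 0 := by
    rw [ht, Finset.sum_sub_distrib]
    simp only [Finset.sum_const, Finset.card_univ, Fintype.card_fin, nsmul_eq_mul]
    rw [mul_div_cancel₀ _ hm0.ne', sub_self]
  have hQeq : ∀ l i, Real.exp (-t l) * (Real.exp (d.improve v e l i / d.reg l) * B l i) = Q i := by
    intro l i
    nth_rewrite 1 [← Real.exp_log (hBpos l i)]
    rw [← Real.exp_add, ← Real.exp_add, hQ, Input.improve, mul_div_cancel_left₀ _ (hd.reg_pos l).ne']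
    simp only [Input.logScale, Finset.sum_sub_distrib, ht]
    congr 1
    simp only [hB]
    ring
  have hQle : ∀ i, m * Q i ≤ ∑ l, Real.exp (v l i / d.reg l) * B l i := by
    intro i
    have h0 : ∑ l, v l i / d.reg l = 0 := by
      have : ∀ l, v l i / d.reg l = c⁻¹ * (d.w l * v l i) := by
        intro l
        have := hd.w_pos l
        have := hd.reg_pos l
        rw [hc, ← hd.w_mul_reg l]
        field_simp
      simp only [this, ← Finset.mul_sum, hv, mul_zero]
    have hJ := convexOn_exp.map_sum_le (t := Finset.univ) (w := fun _ : Fin m => 1 / (m : ℝ))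
      (p := fun l => v l i / d.reg l + Real.log (B l i)) (fun _ _ => by positivity)
      (by simp [hm0.ne']) (fun _ _ => Set.mem_univ _)
    simp only [smul_eq_mul, ← Finset.mul_sum, Finset.sum_add_distrib, h0, zero_add, Real.exp_add,
      Real.exp_log (hBpos _ i)] at hJ
    rw [hQ]
    rw [one_div_mul_eq_div, one_div_mul_eq_div, le_div_iff₀' hm0] at hJ
    exact hJ
  have hQsum : m * ∑ i, Q i ≤ m := by
    calc m * ∑ i, Q i ≤ ∑ i, ∑ l, Real.exp (v l i / d.reg l) * B l i := by
          rw [Finset.mul_sum]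
          exact Finset.sum_le_sum fun i _ => hQle i
      _ = ∑ l, ∑ j, d.p l j * (partFn (d.reg l) (d.C l) (v l) j /
            partFn (d.reg l) (d.C l) (v l) j) := by
          rw [Finset.sum_comm]
          exact Finset.sum_congr rfl fun l _ => sum_exp_mul_colScale _
      _ = m := by
          simp [div_self (partFn_pos _).ne', (hd.p_mem _).2]
  calc d.sepObj (d.improve v e)
      ≤ ∑ l, (d.w l * conjVal (d.reg l) (d.C l) (d.p l) (v l) + c * (∑ i, Q i - 1 + t l)) := by
        refine Finset.sum_le_sum fun l _ => ?_
        have h := conjVal_le_add (C := d.C l) (u := v l) (hd.reg_pos l) (hd.p_mem l)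
          (d.improve v e l) (t l)
        rw [Finset.mul_sum, Finset.sum_congr rfl fun i _ => hQeq l i] at h
        have h' := mul_le_mul_of_nonneg_left h (hd.w_pos l).le
        rw [mul_add, ← mul_assoc (d.w l) (d.reg l), hd.w_mul_reg l] at h'
        exact h'
    _ = d.sepObj v + c * (m * ∑ i, Q i - m) := by
        rw [Finset.sum_add_distrib, ← Finset.mul_sum, Finset.sum_add_distrib, ht0]
        simp only [Finset.sum_const, Finset.card_univ, Fintype.card_fin, nsmul_eq_mul,
          Input.sepObj]
        ring
    _ ≤ d.sepObj v := by nlinarith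

/-- The shift moves the midpoint of the interval containing the logarithms to `0`; hence the factor
`1/2`, which later yields the radius `R / 2`. -/
theorem Input.Valid.exists_logScale_le (hd : d.Valid) (hC : ∀ l i j, 0 ≤ d.C l i j)
    (v : Fin m → Fin n → ℝ) :
    ∃ e, ∀ l i, |d.logScale v e l i| ≤ maxEntry (d.C l) / (2 * d.reg l) := by
  refine ⟨fun l => Real.log (massScale (d.reg l) (d.C l) (d.p l) (v l)) -
    maxEntry (d.C l) / (2 * d.reg l), fun l i => ?_⟩
  have hS := massScale_pos (γ := d.reg l) (C := d.C l) (u := v l) (hd.p_mem l)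
  have h1 := Real.log_le_log (colScale_pos (C := d.C l) (u := v l) (hd.reg_pos l) (hd.p_mem l) i)
    (colScale_le (hd.reg_pos l) (hd.p_mem l) (hC l) i)
  have h2 := Real.log_le_log (mul_pos hS (Real.exp_pos _))
    (le_colScale (C := d.C l) (u := v l) (hd.reg_pos l) (hd.p_mem l) i)
  rw [Real.log_mul hS.ne' (Real.exp_pos _).ne', Real.log_exp] at h2
  have e : -maxEntry (d.C l) / d.reg l = -(2 * (maxEntry (d.C l) / (2 * d.reg l))) := by
    have := hd.reg_pos l
    field_simp
  rw [e] at h2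
  rw [Input.logScale, abs_le]
  constructor <;> linarith

theorem sum_sq_sub_mean_le (hm : m ≠ 0) (x : Fin m → ℝ) :
    ∑ l, ((∑ k, x k) / m - x l) ^ 2 ≤ ∑ l, x l ^ 2 := by
  have hm0 : (0 : ℝ) < m := by positivity
  have e : ∑ l, ((∑ k, x k) / m - x l) ^ 2 = ∑ l, x l ^ 2 - (∑ k, x k) ^ 2 / m := by
    have : ∀ l, ((∑ k, x k) / m - x l) ^ 2 =
        (∑ k, x k) ^ 2 / m ^ 2 - 2 * ((∑ k, x k) / m) * x l + x l ^ 2 := by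
      intro l
      ring
    simp only [this, Finset.sum_add_distrib, Finset.sum_sub_distrib, ← Finset.mul_sum]
    simp only [Finset.sum_const, Finset.card_univ, Fintype.card_fin, nsmul_eq_mul]
    field_simp
    ring
  rw [e]
  have : 0 ≤ (∑ k, x k) ^ 2 / (m : ℝ) := by positivity
  linarith

/-- Since `w_l γ(l) = γ`, the summands are `γ²` times squared deviations from the mean over the
agents, and centring does not increase a sum of squares. -/
theorem Input.Valid.sum_sq_improve_le (hd : d.Valid) (v : Fin m → Fin n → ℝ) {e : Fin m → ℝ}
    (he : ∀ l i, |d.logScale v e l i| ≤ maxEntry (d.C l) / (2 * d.reg l)) :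
    ∑ l, ∑ i, (d.w l * d.improve v e l i) ^ 2 ≤ n * (∑ l, d.w l ^ 2 * maxEntry (d.C l) ^ 2) / 4 := by
  set c : ℝ := d.ε / (4 * m * Real.log n) with hc
  calc ∑ l, ∑ i, (d.w l * d.improve v e l i) ^ 2
      = ∑ i, c ^ 2 * ∑ l, ((∑ k, d.logScale v e k i) / m - d.logScale v e l i) ^ 2 := by
        rw [Finset.sum_comm]
        refine Finset.sum_congr rfl fun i _ => ?_
        rw [Finset.mul_sum]
        refine Finset.sum_congr rfl fun l _ => ?_
        rw [Input.improve, ← mul_assoc, hd.w_mul_reg, mul_pow]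
    _ ≤ ∑ i : Fin n, c ^ 2 * ∑ l, (maxEntry (d.C l) / (2 * d.reg l)) ^ 2 := by
        refine Finset.sum_le_sum fun i _ => mul_le_mul_of_nonneg_left ?_ (sq_nonneg _)
        refine (sum_sq_sub_mean_le hd.m_pos.ne' _).trans (Finset.sum_le_sum fun l _ => ?_)
        exact sq_le_sq' (neg_le_of_abs_le (he l i)) (le_of_abs_le (he l i))
    _ = n * (∑ l, d.w l ^ 2 * maxEntry (d.C l) ^ 2) / 4 := by
        simp only [Finset.sum_const, Finset.card_univ, Fintype.card_fin, nsmul_eq_mul]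
        rw [mul_div_assoc, Finset.mul_sum, Finset.sum_div]
        congr 1
        refine Finset.sum_congr rfl fun l _ => ?_
        have := hd.reg_pos l
        rw [hc, ← hd.w_mul_reg l]
        field_simp
        ring

theorem continuous_conjVal {γ : ℝ} {C : Matrix (Fin n) (Fin n) ℝ} {p : Fin n → ℝ} :
    Continuous (conjVal γ C p) := by
  unfold conjVal
  refine (continuous_const.mul (continuous_finsetSum _ fun j _ => continuous_const.mul
    (Continuous.sub (Continuous.log ?_ fun u => (partFn_pos j).ne') continuous_const))).add
    continuous_const
  unfold partFn
  fun_prop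

/-- A minimizer over the compact set `S` is a minimizer over the whole constraint space, because
`improve` sends each point of that space into `S` without increasing the objective. -/
theorem Input.Valid.exists_sepObj_min (hd : d.Valid) (hC : ∀ l i j, 0 ≤ d.C l i j) :
    ∃ v : Fin m → Fin n → ℝ, (∀ i, ∑ l, d.w l * v l i = 0) ∧
      ∑ l, ∑ i, (d.w l * v l i) ^ 2 ≤ n * (∑ l, d.w l ^ 2 * maxEntry (d.C l) ^ 2) / 4 ∧
      ∀ v' : Fin m → Fin n → ℝ, (∀ i, ∑ l, d.w l * v' l i = 0) → d.sepObj v ≤ d.sepObj v' := by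
  set ρ : ℝ := n * (∑ l, d.w l ^ 2 * maxEntry (d.C l) ^ 2) / 4 with hρ
  have hρ0 : 0 ≤ ρ := by
    have := Finset.sum_nonneg fun (l : Fin m) (_ : l ∈ Finset.univ) =>
      mul_nonneg (sq_nonneg (d.w l)) (sq_nonneg (maxEntry (d.C l)))
    positivity
  set S : Set (Fin m → Fin n → ℝ) :=
    {v | (∀ i, ∑ l, d.w l * v l i = 0) ∧ ∑ l, ∑ i, (d.w l * v l i) ^ 2 ≤ ρ} with hS
  have hclosed : IsClosed S := by
    have h1 : IsClosed {v : Fin m → Fin n → ℝ | ∀ i, ∑ l, d.w l * v l i = 0} := by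
      have : {v : Fin m → Fin n → ℝ | ∀ i, ∑ l, d.w l * v l i = 0} =
          ⋂ i, {v | ∑ l, d.w l * v l i = 0} := by
        ext
        simp
      rw [this]
      exact isClosed_iInter fun i => isClosed_eq (by fun_prop) continuous_const
    have h2 : IsClosed {v : Fin m → Fin n → ℝ | ∑ l, ∑ i, (d.w l * v l i) ^ 2 ≤ ρ} :=
      isClosed_le (by fun_prop) continuous_const
    exact h1.inter h2
  have hcompact : IsCompact S := by
    refine (isCompact_Icc (a := fun l (_ : Fin n) => -(√ρ / d.w l))
      (b := fun l (_ : Fin n) => √ρ / d.w l)).of_isClosed_subset hclosed ?_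
    intro v hv
    have hle : ∀ l i, |v l i| ≤ √ρ / d.w l := by
      intro l i
      rw [le_div_iff₀' (hd.w_pos l), ← abs_of_pos (hd.w_pos l), ← abs_mul]
      refine Real.abs_le_sqrt (le_trans ?_ hv.2)
      calc (d.w l * v l i) ^ 2 ≤ ∑ i, (d.w l * v l i) ^ 2 :=
            Finset.single_le_sum (f := fun i => (d.w l * v l i) ^ 2)
              (fun i _ => sq_nonneg _) (Finset.mem_univ i)
        _ ≤ ∑ l, ∑ i, (d.w l * v l i) ^ 2 :=
            Finset.single_le_sum (f := fun l => ∑ i, (d.w l * v l i) ^ 2)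
              (fun l _ => Finset.sum_nonneg fun i _ => sq_nonneg _) (Finset.mem_univ l)
    exact ⟨fun l i => neg_le_of_abs_le (hle l i), fun l i => le_of_abs_le (hle l i)⟩
  have hcont : Continuous d.sepObj := by
    unfold Input.sepObj
    exact continuous_finsetSum _ fun l _ =>
      continuous_const.mul (continuous_conjVal.comp (continuous_apply l))
  obtain ⟨v, hv, hmin⟩ := hcompact.exists_isMinOn ⟨0, by simp [hS, hρ0]⟩ hcont.continuousOn
  refine ⟨v, hv.1, hv.2, fun v' hv' => ?_⟩
  obtain ⟨e, he⟩ := hd.exists_logScale_le hC v'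
  exact (hmin ⟨hd.sum_improve v' e, hd.sum_sq_improve_le v' he⟩).trans (hd.sepObj_improve_le hv' e)

/-- The substitution `λ_l = [√W u]_l / w_l`. -/
def Input.dualMap (d : Input m n) (u : Fin m × Fin n → ℝ) : Fin m → Fin n → ℝ :=
  fun l i => (sqrtW n d.Wbar *ᵥ u) (l, i) / d.w l

theorem Input.Valid.lifts_dualMap (hd : d.Valid) (u : Fin m × Fin n → ℝ) :
    d.Lifts u (d.dualMap u) := fun l _ => (mul_div_cancel₀ _ (hd.w_pos l).ne').symm

theorem Input.Valid.dualObjective_eq (hd : d.Valid) (u : Fin m × Fin n → ℝ) :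
    dualObjective d.ε d.w d.C d.Wbar d.p u = d.sepObj (d.dualMap u) :=
  Finset.sum_congr rfl fun l _ => congrArg (d.w l * ·)
    (regOtConj_eq_conjVal (hd.reg_pos l) (hd.p_mem l))

/-- Pair `√W u` with the stack of `m` copies of the `i`-th unit vector, which `√W` annihilates. -/
theorem Input.Valid.sum_eq_zero_of_lifts (hd : d.Valid)
    (hker : LinearMap.ker d.Wbar.mulVecLin = Submodule.span ℝ {fun _ => (1 : ℝ)})
    {u : Fin m × Fin n → ℝ} {v : Fin m → Fin n → ℝ} (h : d.Lifts u v) (i : Fin n) :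
    ∑ l, d.w l * v l i = 0 := by
  have h1 := sqrtW_mulVec_const hd.posSemidef hker (Pi.single i 1 : Fin n → ℝ)
  have h2 := h.dotProduct_stack fun _ => (Pi.single i 1 : Fin n → ℝ)
  have h3 : stack (fun _ : Fin m => (Pi.single i 1 : Fin n → ℝ)) =
    fun x : Fin m × Fin n => (Pi.single i 1 : Fin n → ℝ) x.2 := rfl
  rw [h3, h1, zero_dotProduct] at h2
  simpa [Pi.single_apply] using h2.symm

/-- The dual problem has a solution in the ball of radius `R / 2`. -/
theorem Input.Valid.exists_dual_solution (hd : d.Valid) (hm : 2 ≤ m)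
    (hC : ∀ l i j, 0 ≤ d.C l i j)
    (hker : LinearMap.ker d.Wbar.mulVecLin = Submodule.span ℝ {fun _ => (1 : ℝ)}) :
    ∃ u v, d.Lifts u v ∧ norm2 u ≤ dualRadius 1 d.w d.C d.Wbar / 2 ∧
      ∀ u' v', d.Lifts u' v' → d.sepObj v ≤ d.sepObj v' := by
  have hn : n ≠ 0 := by
    have := hd.two_le_n
    omega
  obtain ⟨v, hv, hle, hmin⟩ := hd.exists_sepObj_min hC
  obtain ⟨u, hu, hule⟩ := exists_sqrtW_mulVec_eq hn hm hd.posSemidef hker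
    (v := fun l i => d.w l * v l i) hv
  refine ⟨u, v, fun l i => congrFun hu (l, i), ?_,
    fun u' v' h' => hmin v' (hd.sum_eq_zero_of_lifts hker h')⟩
  have hpos := lamMinPos_pos (posSemidef_bigW (n := n) hd.posSemidef)
    (bigW_ne_zero hn (ne_zero_of_ker hm hker))
  have h1 : stack (fun l i => d.w l * v l i) ⬝ᵥ stack (fun l i => d.w l * v l i) =
      ∑ l, ∑ i, (d.w l * v l i) ^ 2 := by
    simp [dotProduct, Fintype.sum_prod_type, stack, sq]
  rw [h1] at hule
  rw [le_div_iff₀ two_pos, dualRadius]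
  refine Real.le_sqrt_of_sq_le ?_
  rw [mul_pow, norm2_sq]
  have h2 := hule.trans (div_le_div_of_nonneg_right hle hpos.le)
  calc u ⬝ᵥ u * 2 ^ 2 ≤ n * (∑ l, d.w l ^ 2 * maxEntry (d.C l) ^ 2) / 4 /
        lamMinPos (bigW n d.Wbar) * 2 ^ 2 := by linarith
    _ = _ := by
      field_simp
      ring

end DualSolution

/-! ### Accuracy of the output -/

section Accuracy

variable {m n : ℕ} {d : Input m n}

theorem Certificate.mem_couplings {s : State m n} {z y : Fin m × Fin n → ℝ}
    {π : Fin m → Matrix (Fin n) (Fin n) ℝ} (h : Certificate d s z y π) (hA : 0 < s.A)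
    (l : Fin m) : π l ∈ couplings (d.p l) (s.q l) :=
  ⟨h.nonneg l, fun j => mul_left_cancel₀ hA.ne' (h.row l j),
    fun i => mul_left_cancel₀ hA.ne' (h.col l i)⟩

theorem Input.Valid.run_q_mem (hd : d.Valid) {N : ℕ} (hN : 1 ≤ N) (l : Fin m) :
    (run d N).q l ∈ stdSimplex ℝ (Fin n) := by
  obtain ⟨z, y, π, h⟩ := hd.exists_certificate_run N
  exact mem_stdSimplex_of_mem_couplings (hd.p_mem l) (h.mem_couplings (hd.run_A_pos hN) l)

/-- The invariant gives `φ(y) + P(π) ≤ 0`, and weak duality for plans with common column sums gives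
`0 ≤ P(π') + φ(y)`. Dropping the entropies from `P(π) ≤ P(π')` costs at most `γ · m · 2 ln n = ε /
2`. -/
theorem Input.Valid.sum_cost_le (hd : d.Valid)
    (hker : LinearMap.ker d.Wbar.mulVecLin = Submodule.span ℝ {fun _ => (1 : ℝ)}) {s : State m n}
    {z y : Fin m × Fin n → ℝ} {π : Fin m → Matrix (Fin n) (Fin n) ℝ} (h : Certificate d s z y π)
    (hA : 0 < s.A) {q' : Fin n → ℝ} {π' : Fin m → Matrix (Fin n) (Fin n) ℝ}
    (hπ' : ∀ l, π' l ∈ couplings (d.p l) q') :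
    ∑ l, d.w l * cost (d.C l) (π l) ≤ ∑ l, d.w l * cost (d.C l) (π' l) + d.ε / 2 := by
  have h1 : d.sepObj s.eta + d.planObj π ≤ 0 := by
    have h0 : 0 ≤ z ⬝ᵥ z := by
      rw [← norm2_sq]
      positivity
    have hb := h.bound
    by_contra! hlt
    linarith [mul_pos hA hlt]
  have h2 := hd.neg_sepObj_le hπ' s.eta
  have h3 : ∑ l, d.w l * ∑ i, q' i * s.eta l i = 0 := by
    simp only [Finset.mul_sum]
    rw [Finset.sum_comm]
    refine Finset.sum_eq_zero fun i _ => ?_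
    rw [← mul_zero (q' i), ← hd.sum_eq_zero_of_lifts hker h.eta i, Finset.mul_sum]
    exact Finset.sum_congr rfl fun l _ => by ring
  rw [h3] at h2
  have h4 : d.planObj π ≤ d.planObj π' := by linarith
  set c : ℝ := d.ε / (4 * m * Real.log n) with hc
  have hm0 : (0 : ℝ) < m := by exact_mod_cast hd.m_pos
  have hlog := hd.log_pos
  have hc0 : 0 < c := by
    have := hd.eps_pos
    positivity
  have e : ∀ ρ : Fin m → Matrix (Fin n) (Fin n) ℝ,
      d.planObj ρ = ∑ l, d.w l * cost (d.C l) (ρ l) + c * ∑ l, negEntropy (ρ l) := by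
    intro ρ
    rw [Input.planObj, Finset.mul_sum, ← Finset.sum_add_distrib]
    refine Finset.sum_congr rfl fun l _ => ?_
    rw [planValue, mul_add, ← mul_assoc, hd.w_mul_reg]
  have h5 : ∑ l, negEntropy (π' l) - ∑ l, negEntropy (π l) ≤ m * (2 * Real.log n) := by
    rw [← Finset.sum_sub_distrib]
    refine (Finset.sum_le_card_nsmul _ _ (2 * Real.log n) fun l _ => ?_).trans_eq (by simp)
    linarith [negEntropy_le (hd.p_mem l) (hπ' l),
      le_negEntropy (hd.p_mem l) (h.mem_couplings hA l)]
  have h6 := mul_le_mul_of_nonneg_left h5 hc0.le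
  have e6 : c * (m * (2 * Real.log n)) = d.ε / 2 := by
    rw [hc]
    field_simp
    ring
  rw [e, e] at h4
  linarith

theorem Input.Valid.gap_le (hd : d.Valid) (hw : ∑ l, d.w l = 1) (hC : ∀ l i j, 0 ≤ d.C l i j)
    (hker : LinearMap.ker d.Wbar.mulVecLin = Submodule.span ℝ {fun _ => (1 : ℝ)}) {N : ℕ}
    (hN : 1 ≤ N) {q' : Fin n → ℝ} (hq' : q' ∈ stdSimplex ℝ (Fin n)) :
    ∑ l, d.w l * otCost (d.C l) (d.p l) ((run d N).q l) -
      ∑ l, d.w l * otCost (d.C l) (d.p l) q' ≤ d.ε / 2 := by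
  obtain ⟨z, y, π, h⟩ := hd.exists_certificate_run N
  have hA := hd.run_A_pos hN
  -- Couplings within `δ` of the infimum suffice, so attainment is not needed; as the weights sum to
  -- `1`, the total loss is `δ`.
  refine le_of_forall_pos_le_add fun δ hδ => ?_
  have hex : ∀ l, ∃ ρ ∈ couplings (d.p l) q',
      cost (d.C l) ρ < otCost (d.C l) (d.p l) q' + δ := by
    intro l
    obtain ⟨_, ⟨ρ, hρ, rfl⟩, hlt⟩ := exists_lt_of_csInf_lt
      (⟨_, _, product_mem_couplings (hd.p_mem l) hq', rfl⟩ :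
        (cost (d.C l) '' couplings (d.p l) q').Nonempty)
      (show otCost (d.C l) (d.p l) q' < otCost (d.C l) (d.p l) q' + δ by linarith)
    exact ⟨ρ, hρ, hlt⟩
  choose π' hπ' hlt using hex
  have h1 := hd.sum_cost_le hker h hA hπ'
  have h2 : ∑ l, d.w l * otCost (d.C l) (d.p l) ((run d N).q l) ≤
      ∑ l, d.w l * cost (d.C l) (π l) :=
    Finset.sum_le_sum fun l _ => mul_le_mul_of_nonneg_left
      (otCost_le (hC l) (h.mem_couplings hA l)) (hd.w_pos l).le
  have h3 : ∑ l, d.w l * cost (d.C l) (π' l) ≤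
      ∑ l, (d.w l * otCost (d.C l) (d.p l) q' + d.w l * δ) := by
    refine Finset.sum_le_sum fun l _ => ?_
    rw [← mul_add]
    exact mul_le_mul_of_nonneg_left (hlt l).le (hd.w_pos l).le
  rw [Finset.sum_add_distrib, ← Finset.sum_mul, hw] at h3
  linarith

theorem dotProduct_le_norm2_mul {ι : Type*} [Fintype ι] (x y : ι → ℝ) :
    x ⬝ᵥ y ≤ norm2 x * norm2 y := by
  have := real_inner_le_norm (WithLp.toLp 2 y) (WithLp.toLp 2 x)
  rw [EuclideanSpace.inner_toLp_toLp] at this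
  rw [norm2, norm2, mul_comm]
  simpa using this

theorem norm2_neg {ι : Type*} [Fintype ι] (x : ι → ℝ) : norm2 (-x) = norm2 x := by
  rw [norm2, norm2, WithLp.toLp_neg, norm_neg]

/-- With `s = √W q`, weak duality at the minimizer `u` gives `φ(y) + P(π) ≥ ⟨s, u⟩ ≥ -‖s‖ ‖u‖`,
while the invariant gives `φ(y) + P(π) ≤ -A ‖s‖² / 2`. -/
theorem Input.Valid.A_mul_norm2_le (hd : d.Valid) {N : ℕ} (hN : 1 ≤ N)
    {u : Fin m × Fin n → ℝ} {v : Fin m → Fin n → ℝ} (hu : d.Lifts u v)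
    (hmin : ∀ u' v', d.Lifts u' v' → d.sepObj v ≤ d.sepObj v') :
    (run d N).A * norm2 (sqrtW n d.Wbar *ᵥ stack (run d N).q) ≤ 2 * norm2 u := by
  obtain ⟨z, y, π, h⟩ := hd.exists_certificate_run N
  have hA := hd.run_A_pos hN
  set A := (run d N).A
  set s := sqrtW n d.Wbar *ᵥ stack (run d N).q
  have h1 := hd.neg_sepObj_le (h.mem_couplings hA) v
  rw [← hu.dotProduct_stack] at h1
  have h2 := hmin y _ h.eta
  have h3 := h.bound
  rw [h.z_eq, smul_dotProduct, dotProduct_smul, ← norm2_sq, smul_eq_mul, smul_eq_mul] at h3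
  have h4 := dotProduct_le_norm2_mul (-s) u
  rw [norm2_neg, neg_dotProduct] at h4
  have h5 : A * (A * norm2 s ^ 2 / 2) ≤ A * (norm2 s * norm2 u) := by
    have : A * (s ⬝ᵥ u) ≤ A * (d.sepObj (run d N).eta + d.planObj π) :=
      mul_le_mul_of_nonneg_left (by linarith) hA.le
    nlinarith [mul_le_mul_of_nonneg_left h4 hA.le]
  have h6 := le_of_mul_le_mul_left h5 hA
  have hs : 0 ≤ norm2 s := norm_nonneg _
  rcases hs.eq_or_lt with h0 | h0
  · rw [← h0, mul_zero]
    exact mul_nonneg two_pos.le (norm_nonneg _)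
  · refine le_of_mul_le_mul_left ?_ h0
    linarith

theorem sum_sq_maxEntry_nonneg (w : Fin m → ℝ) (C : Fin m → Matrix (Fin n) (Fin n) ℝ) :
    0 ≤ ∑ l, w l ^ 2 * maxEntry (C l) ^ 2 :=
  Finset.sum_nonneg fun _ _ => mul_nonneg (sq_nonneg _) (sq_nonneg _)

theorem sq_dualRadius (hn : n ≠ 0) {Wbar : Matrix (Fin m) (Fin m) ℝ} (hW : Wbar.PosSemidef)
    (h0 : Wbar ≠ 0) {c : ℝ} (hc : 0 ≤ c) (w : Fin m → ℝ)
    (C : Fin m → Matrix (Fin n) (Fin n) ℝ) :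
    dualRadius c w C Wbar ^ 2 = c * n * (∑ l, w l ^ 2 * maxEntry (C l) ^ 2) / lamMinPos Wbar := by
  have := lamMinPos_pos hW h0
  have := sum_sq_maxEntry_nonneg w C
  rw [dualRadius, lamMinPos_bigW hn, Real.sq_sqrt (by positivity)]

/-- The left side equals `4 ε` times the square of `iterBound c`. -/
theorem Input.Valid.mul_sq_dualRadius_le (hd : d.Valid) (h0 : d.Wbar ≠ 0) {c : ℝ} (hc : 0 ≤ c)
    {N : ℕ} (hN : iterBound c d.ε d.w d.C d.Wbar ≤ N) :
    c * (d.L * dualRadius 1 d.w d.C d.Wbar ^ 2) ≤ 4 * (d.ε * N ^ 2) := by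
  have hn : n ≠ 0 := by
    have := hd.two_le_n
    omega
  have hmin := lamMinPos_pos hd.posSemidef h0
  have hmax := lamMax_pos hd.posSemidef h0
  have hS := sum_sq_maxEntry_nonneg d.w d.C
  have hlog := hd.log_pos
  have hε := hd.eps_pos
  have hm0 : (0 : ℝ) < m := by exact_mod_cast hd.m_pos
  have hb0 : 0 ≤ iterBound c d.ε d.w d.C d.Wbar := by
    unfold iterBound
    positivity
  have hsq := mul_le_mul_of_nonneg_left (pow_le_pow_left₀ hb0 hN 2) hε.le
  have hcond : 0 < condNumber d.Wbar := div_pos hmax hmin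
  rw [iterBound, mul_pow, Real.sq_sqrt (by positivity)] at hsq
  rw [sq_dualRadius hn hd.posSemidef h0 zero_le_one, hd.L_eq, lipConst, lamMax_bigW hn]
  refine le_trans (le_of_eq ?_) (mul_le_mul_of_nonneg_left hsq (by norm_num : (0 : ℝ) ≤ 4))
  rw [condNumber]
  field_simp

/-- The dual solution of norm at most `R / 2` gives `A ‖√W q‖ ≤ R`. The bounds `N² ≤ 8 L A` and `64
r L R² ≤ 4 ε N²` give `2 r R² ≤ ε A`. -/
theorem Input.Valid.norm2_consensus_le (hd : d.Valid) (hm : 2 ≤ m) (hC : ∀ l i j, 0 ≤ d.C l i j)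
    (hker : LinearMap.ker d.Wbar.mulVecLin = Submodule.span ℝ {fun _ => (1 : ℝ)}) {N : ℕ}
    (hN : 1 ≤ N) {c r : ℝ} (hr : 1 ≤ r) (hcr : 64 * r ≤ c)
    (hb : iterBound c d.ε d.w d.C d.Wbar ≤ N) :
    norm2 (sqrtW n d.Wbar *ᵥ stack (run d N).q) ≤ d.ε / (2 * dualRadius r d.w d.C d.Wbar) := by
  have h0 := ne_zero_of_ker hm hker
  have hn : n ≠ 0 := by
    have := hd.two_le_n
    omega
  obtain ⟨u, v, hu, hle, hmin⟩ := hd.exists_dual_solution hm hC hker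
  have h1 := hd.A_mul_norm2_le hN hu hmin
  have hA := hd.run_A_pos hN
  have h2 := hd.mul_sq_dualRadius_le h0 (by linarith) hb
  have h3 := hd.sq_le_run_A N
  set A := (run d N).A
  set s := norm2 (sqrtW n d.Wbar *ᵥ stack (run d N).q)
  set R := dualRadius 1 d.w d.C d.Wbar with hR
  have hRr : dualRadius r d.w d.C d.Wbar = √r * R := by
    rw [hR, dualRadius, dualRadius, ← Real.sqrt_mul (by linarith)]
    congr 1
    ring
  have hR0 : 0 ≤ R := Real.sqrt_nonneg _
  have hs0 : 0 ≤ s := norm_nonneg _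
  have hL := hd.L_pos
  have hε := hd.eps_pos
  have hAs : A * s ≤ R := by linarith
  rw [hRr]
  rcases hR0.eq_or_lt with h | hRpos
  -- For `R = 0` the right side is `0` by the convention for division, and the claim is exact
  -- consensus.
  · rw [← h, mul_zero, mul_zero, div_zero]
    rw [← h] at hAs
    exact nonpos_of_mul_nonpos_right hAs hA
  · have hr0 : 0 < √r := Real.sqrt_pos.2 (by linarith)
    have hrr : √r ≤ r := by
      rw [Real.sqrt_le_left (by linarith)]
      nlinarith
    rw [le_div_iff₀ (by positivity)]
    have h4 : 64 * r * (d.L * R ^ 2) ≤ 32 * d.ε * (d.L * A) := by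
      have ha : 64 * r * (d.L * R ^ 2) ≤ c * (d.L * R ^ 2) :=
        mul_le_mul_of_nonneg_right hcr (by positivity)
      have hb := mul_le_mul_of_nonneg_left h3 hε.le
      linarith
    have h5 : 2 * r * R ^ 2 ≤ d.ε * A := by
      refine le_of_mul_le_mul_left ?_ hL
      linarith
    refine le_of_mul_le_mul_left ?_ hA
    calc A * (s * (2 * (√r * R))) = (A * s) * (2 * √r * R) := by ring
      _ ≤ R * (2 * r * R) := by gcongr
      _ ≤ A * d.ε := by linarith

theorem Input.Valid.exists_isMinOn_dualObjective (hd : d.Valid) (hm : 2 ≤ m)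
    (hC : ∀ l i j, 0 ≤ d.C l i j)
    (hker : LinearMap.ker d.Wbar.mulVecLin = Submodule.span ℝ {fun _ => (1 : ℝ)}) :
    ∃ u, IsMinOn (dualObjective d.ε d.w d.C d.Wbar d.p) Set.univ u ∧
      norm2 u ≤ dualRadius 1 d.w d.C d.Wbar := by
  obtain ⟨u, v, hu, hle, hmin⟩ := hd.exists_dual_solution hm hC hker
  refine ⟨u, fun u' _ => ?_, hle.trans (half_le_self (Real.sqrt_nonneg _))⟩
  have hv : d.dualMap u = v := by
    funext l i
    rw [Input.dualMap, hu l i, mul_div_cancel_left₀ _ (hd.w_pos l).ne']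
  change dualObjective d.ε d.w d.C d.Wbar d.p u ≤ dualObjective d.ε d.w d.C d.Wbar d.p u'
  rw [hd.dualObjective_eq, hd.dualObjective_eq, hv]
  exact hmin u' _ (hd.lifts_dualMap u')

/-- The accuracy of the output for the measures before the replacement. -/
theorem Input.Valid.gap_le_of_admissible (hd : d.Valid) (hw : ∑ l, d.w l = 1)
    (hC : ∀ l i j, 0 ≤ d.C l i j)
    (hker : LinearMap.ker d.Wbar.mulVecLin = Submodule.span ℝ {fun _ => (1 : ℝ)}) {N : ℕ}
    (hN : 1 ≤ N) {p : Fin m → Fin n → ℝ} (hp : ∀ l, p l ∈ stdSimplex ℝ (Fin n))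
    (hadm : ∀ l, Admissible d.ε (p l) (d.p l)) {q' : Fin n → ℝ}
    (hq' : q' ∈ stdSimplex ℝ (Fin n)) :
    ∑ l, d.w l * otCost (d.C l) (p l) ((run d N).q l) - ∑ l, d.w l * otCost (d.C l) (p l) q' ≤
      d.ε / 2 + d.ε / 4 * ∑ l, d.w l * maxEntry (d.C l) := by
  have h1 := hd.gap_le hw hC hker hN hq'
  -- The measures are exchanged twice, at the output and at `q'`, so `ε / 8` becomes `ε / 4`.
  have hM : ∀ l, maxEntry (d.C l) / 2 * ∑ i, |d.p l i - p l i| ≤ maxEntry (d.C l) * (d.ε / 8) := by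
    intro l
    have h := mul_le_mul_of_nonneg_left (hadm l).2.1 (half_pos two_pos).le
    have := mul_le_mul_of_nonneg_left (hadm l).2.1
      (div_nonneg (maxEntry_nonneg (hC l)) (zero_le_two (α := ℝ)))
    linarith
  have h2 : ∑ l, d.w l * otCost (d.C l) (p l) ((run d N).q l) ≤
      ∑ l, (d.w l * otCost (d.C l) (d.p l) ((run d N).q l) +
        d.ε / 8 * (d.w l * maxEntry (d.C l))) := by
    refine Finset.sum_le_sum fun l _ => ?_
    have h := otCost_le_add (hC l) (hp l) (hd.p_mem l) (hd.run_q_mem hN l)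
    simp only [abs_sub_comm (p l _)] at h
    have := mul_le_mul_of_nonneg_left (h.trans (add_le_add_right (hM l) _)) (hd.w_pos l).le
    linarith
  have h3 : ∑ l, d.w l * otCost (d.C l) (d.p l) q' ≤
      ∑ l, (d.w l * otCost (d.C l) (p l) q' + d.ε / 8 * (d.w l * maxEntry (d.C l))) := by
    refine Finset.sum_le_sum fun l _ => ?_
    have h := otCost_le_add (hC l) (hd.p_mem l) (hp l) hq'
    have := mul_le_mul_of_nonneg_left (h.trans (add_le_add_right (hM l) _)) (hd.w_pos l).le
    linarith
  rw [Finset.sum_add_distrib, ← Finset.mul_sum] at h2 h3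
  linarith

end Accuracy

/-! ### Straight-line programs -/

section Programs

variable {D : Type} {S S' S'' : Set (D → ℝ)} {f g : D → ℝ} {k k' : ℕ}

theorem OneOp.mono (h : OneOp S f) (hS : S ⊆ S') : OneOp S' f := by
  cases h with
  | const c => exact .const c
  | add hf hg => exact .add (hS hf) (hS hg)
  | sub hf hg => exact .sub (hS hf) (hS hg)
  | mul hf hg => exact .mul (hS hf) (hS hg)
  | div hf hg => exact .div (hS hf) (hS hg)
  | sqrt hf => exact .sqrt (hS hf)
  | exp hf => exact .exp (hS hf)
  | log hf => exact .log (hS hf)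

theorem Program.subset (h : Program S k S') : S ⊆ S' := by
  induction h with
  | init => exact subset_rfl
  | step _ _ ih => exact ih.trans (Set.subset_insert _ _)

theorem Program.union (h : Program S k S') (T : Set (D → ℝ)) : Program (S ∪ T) k (S' ∪ T) := by
  induction h with
  | init => exact .init
  | step _ hf ih =>
    rw [Set.insert_union]
    exact .step ih (hf.mono Set.subset_union_left)

theorem Program.trans (h : Program S k S') (h' : Program S' k' S'') :
    Program S (k + k') S'' := by
  induction h' with
  | init => exact h
  | step _ hf ih => exact .step ih hf

/-- The memory contents `S'` can be reached from `S` with at most `k` operations. -/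
def Reach (S : Set (D → ℝ)) (k : ℕ) (S' : Set (D → ℝ)) : Prop := ∃ j ≤ k, Program S j S'

theorem Reach.subset (h : Reach S k S') : S ⊆ S' := h.choose_spec.2.subset

theorem Reach.refl (S : Set (D → ℝ)) : Reach S 0 S := ⟨0, le_rfl, .init⟩

theorem Reach.trans (h : Reach S k S') (h' : Reach S' k' S'') : Reach S (k + k') S'' := by
  obtain ⟨i, hi, p⟩ := h
  obtain ⟨j, hj, p'⟩ := h'
  exact ⟨i + j, add_le_add hi hj, p.trans p'⟩

theorem Reach.le (h : Reach S k S') (hk : k ≤ k') : Reach S k' S' := by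
  obtain ⟨i, hi, p⟩ := h
  exact ⟨i, hi.trans hk, p⟩

/-- The value `f` can be computed from the memory contents `S` with at most `k` operations. -/
def Comp (S : Set (D → ℝ)) (k : ℕ) (f : D → ℝ) : Prop := ∃ S', Reach S k S' ∧ f ∈ S'

namespace Comp

theorem of_mem (h : f ∈ S) : Comp S 0 f := ⟨S, .refl S, h⟩

/-- The same program runs with the extra values kept in memory; this makes the costs of successive
computations add up. -/
theorem mono (h : Comp S k f) (hS : S ⊆ S') : Comp S' k f := by
  obtain ⟨T, ⟨j, hj, p⟩, hf⟩ := h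
  refine ⟨T ∪ S', ⟨j, hj, ?_⟩, Or.inl hf⟩
  simpa only [Set.union_eq_self_of_subset_left hS] using p.union S'

theorem of_op {T : Set (D → ℝ)} (hr : Reach S k T) (h : OneOp T f) : Comp S (k + 1) f :=
  ⟨insert f T, hr.trans ⟨1, le_rfl, .step .init h⟩, Set.mem_insert _ _⟩

theorem both (hf : Comp S k f) (hg : Comp S k' g) :
    ∃ T, Reach S (k + k') T ∧ f ∈ T ∧ g ∈ T := by
  obtain ⟨T, hT, hfT⟩ := hf
  obtain ⟨T', hT', hgT⟩ := hg.mono hT.subset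
  exact ⟨T', hT.trans hT', hT'.subset hfT, hgT⟩

theorem const (S : Set (D → ℝ)) (c : ℕ) : Comp S 1 fun _ => (c : ℝ) :=
  of_op (.refl S) (.const c)

theorem ofNat (S : Set (D → ℝ)) (c : ℕ) [c.AtLeastTwo] :
    Comp S 1 fun _ => (OfNat.ofNat c : ℝ) :=
  const S c

theorem one (S : Set (D → ℝ)) : Comp S 1 fun _ => (1 : ℝ) := by
  simpa using const S 1

theorem zero (S : Set (D → ℝ)) : Comp S 1 fun _ => (0 : ℝ) := by
  simpa using const S 0

theorem add (hf : Comp S k f) (hg : Comp S k' g) : Comp S (k + k' + 1) fun d => f d + g d := by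
  obtain ⟨T, hT, h, h'⟩ := hf.both hg
  exact of_op hT (.add h h')

theorem sub (hf : Comp S k f) (hg : Comp S k' g) : Comp S (k + k' + 1) fun d => f d - g d := by
  obtain ⟨T, hT, h, h'⟩ := hf.both hg
  exact of_op hT (.sub h h')

theorem mul (hf : Comp S k f) (hg : Comp S k' g) : Comp S (k + k' + 1) fun d => f d * g d := by
  obtain ⟨T, hT, h, h'⟩ := hf.both hg
  exact of_op hT (.mul h h')

theorem div (hf : Comp S k f) (hg : Comp S k' g) : Comp S (k + k' + 1) fun d => f d / g d := by
  obtain ⟨T, hT, h, h'⟩ := hf.both hg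
  exact of_op hT (.div h h')

theorem sqrt (hf : Comp S k f) : Comp S (k + 1) fun d => √(f d) := by
  obtain ⟨T, hT, h⟩ := hf
  exact of_op hT (.sqrt h)

theorem exp (hf : Comp S k f) : Comp S (k + 1) fun d => Real.exp (f d) := by
  obtain ⟨T, hT, h⟩ := hf
  exact of_op hT (.exp h)

theorem log (hf : Comp S k f) : Comp S (k + 1) fun d => Real.log (f d) := by
  obtain ⟨T, hT, h⟩ := hf
  exact of_op hT (.log h)

theorem sum {ι : Type*} (s : Finset ι) {F : ι → D → ℝ} (h : ∀ i, Comp S k (F i)) :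
    Comp S (s.card * (k + 1) + 1) fun d => ∑ i ∈ s, F i d := by
  classical
  induction s using Finset.induction_on with
  | empty => simpa using zero S
  | insert i s hi ih =>
    simp only [Finset.sum_insert hi, Finset.card_insert_of_notMem hi]
    have := (h i).add ih
    rwa [show k + (s.card * (k + 1) + 1) + 1 = (s.card + 1) * (k + 1) + 1 by ring] at this

end Comp

theorem exists_reach_finset {ι : Type*} (s : Finset ι) {F : ι → D → ℝ} {c : ι → ℕ}
    (h : ∀ i, Comp S (c i) (F i)) : ∃ T, Reach S (∑ i ∈ s, c i) T ∧ ∀ i ∈ s, F i ∈ T := by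
  classical
  induction s using Finset.induction_on with
  | empty => exact ⟨S, .refl S, by simp⟩
  | insert i s hi ih =>
    obtain ⟨T, hT, hF⟩ := ih
    obtain ⟨T', hT', hi'⟩ := (h i).mono hT.subset
    refine ⟨T', ?_, fun j hj => ?_⟩
    · rw [Finset.sum_insert hi, add_comm]
      exact hT.trans hT'
    · rcases Finset.mem_insert.1 hj with rfl | hj
      · exact hi'
      · exact hT'.subset (hF j hj)

theorem exists_reach {ι : Type*} [Fintype ι] {F : ι → D → ℝ} {c : ι → ℕ}
    (h : ∀ i, Comp S (c i) (F i)) : ∃ T, Reach S (∑ i, c i) T ∧ ∀ i, F i ∈ T := by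
  obtain ⟨T, hT, hF⟩ := exists_reach_finset Finset.univ h
  exact ⟨T, hT, fun i => hF i (Finset.mem_univ i)⟩

/-- A family indexed by the agents and the support. -/
theorem exists_reach_grid {m n : ℕ} {F : Fin m → Fin n → D → ℝ} (h : ∀ l i, Comp S k (F l i)) :
    ∃ T, Reach S (m * n * k) T ∧ ∀ l i, F l i ∈ T := by
  obtain ⟨T, hT, hF⟩ := exists_reach (F := fun x : Fin m × Fin n => F x.1 x.2)
    (c := fun _ => k) fun x => h x.1 x.2
  exact ⟨T, by simpa using hT, fun l i => hF (l, i)⟩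

end Programs

/-! ### The number of operations of the algorithm -/

section OperationCount

variable {m : ℕ} (n : ℕ) (Wbar : Matrix (Fin m) (Fin m) ℝ)

/-- The variables after `k` iterations. -/
def stateValues (k : ℕ) : Set (InputOn n Wbar → ℝ) :=
  {f | (f = fun d => (run d.1.smoothed k).A) ∨ ∃ l i,
    (f = fun d => (run d.1.smoothed k).lam l i) ∨ (f = fun d => (run d.1.smoothed k).zeta l i) ∨
    (f = fun d => (run d.1.smoothed k).eta l i) ∨ f = fun d => (run d.1.smoothed k).q l i}

/-- The numbers that are given, the replaced measures, the regularization parameters, and the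
variables after at most `k` iterations. -/
def memory (k : ℕ) : Set (InputOn n Wbar → ℝ) :=
  inputValues n Wbar ∪ {f | (∃ l i, f = fun d => d.1.smoothed.p l i) ∨
    ∃ l, f = fun d => gam n d.1.ε d.1.w l} ∪ {f | ∃ j ≤ k, f ∈ stateValues n Wbar j}

variable {n Wbar}

theorem exists_reach_memory_zero :
    ∃ S, Reach (inputValues n Wbar) (11 * (m * n) + 8 * m + 1) S ∧ memory n Wbar 0 ⊆ S := by
  set I := inputValues n Wbar with hI
  have hp : ∀ l i, (fun d : InputOn n Wbar => d.1.p l i) ∈ I :=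
    fun l i => Or.inl ⟨l, i, rfl⟩
  have hw : ∀ l, (fun d : InputOn n Wbar => d.1.w l) ∈ I := fun l => Or.inr (Or.inl ⟨l, rfl⟩)
  have hε : (fun d : InputOn n Wbar => d.1.ε) ∈ I :=
    Or.inr (Or.inr (Or.inr (Or.inr (Or.inl rfl))))
  obtain ⟨S1, r1, h1⟩ := exists_reach_grid (S := I) (k := 11)
    (F := fun l i (d : InputOn n Wbar) => (1 - d.1.ε / 8) *
      (d.1.p l i + d.1.ε / (n * (8 - d.1.ε)))) fun l i =>
    ((Comp.one I).sub ((Comp.of_mem hε).div (Comp.ofNat I 8))).mul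
      ((Comp.of_mem (hp l i)).add ((Comp.of_mem hε).div
        ((Comp.const I n).mul ((Comp.ofNat I 8).sub (Comp.of_mem hε)))))
  have hε1 := r1.subset hε
  obtain ⟨S2, r2, h2⟩ := exists_reach (S := S1) (c := fun _ : Fin m => 8)
    (F := fun l (d : InputOn n Wbar) => d.1.ε / (4 * m * d.1.w l * Real.log n)) fun l =>
    (Comp.of_mem hε1).div ((((Comp.ofNat S1 4).mul (Comp.const S1 m)).mul
      (Comp.of_mem (r1.subset (hw l)))).mul (Comp.const S1 n).log)
  obtain ⟨S3, r3, h3⟩ := Comp.zero S2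
  refine ⟨S3, ((r1.trans r2).trans r3).le ?_, ?_⟩
  · simp
    linarith
  · rintro f ((hf | ⟨l, i, rfl⟩ | ⟨l, rfl⟩) | ⟨j, hj, hf⟩)
    · exact r3.subset (r2.subset (r1.subset hf))
    · exact r3.subset (r2.subset (h1 l i))
    · exact r3.subset (h2 l)
    · obtain rfl : j = 0 := Nat.le_zero.1 hj
      -- All variables start as the zero function, so a single constant represents them.
      rcases hf with rfl | ⟨l, i, rfl | rfl | rfl | rfl⟩ <;> exact h3

theorem sum_card_support :
    ∑ x : Fin m × Fin n, (Finset.univ.filter fun j => Wbar x.1 j ≠ 0).card = n * nnz Wbar := by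
  have h : nnz Wbar = ∑ l, (Finset.univ.filter fun j => Wbar l j ≠ 0).card := by
    rw [nnz, Set.ncard_eq_toFinset_card', ← Finset.card_sigma]
    refine Finset.card_bij (fun e _ => ⟨e.1, e.2⟩) ?_ ?_ ?_
    · intro e he
      simpa using he
    · rintro ⟨a, b⟩ _ ⟨a', b'⟩ _ h
      simpa using h
    · rintro ⟨a, b⟩ h
      exact ⟨(a, b), by simpa using h, rfl⟩
  rw [h, Fintype.sum_prod_type, Finset.mul_sum]
  simp

/-- The terms of order `m n²` pay for the exponentials, their row sums `Z` and the gradients.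
Storing `Z` keeps a gradient entry at `O(n)` operations. -/
theorem exists_reach_memory_succ (k : ℕ) :
    ∃ S, Reach (memory n Wbar k)
      (m * n * n * 3 + m * n * (n * 4) + 2 * (n * nnz Wbar) + 22 * (m * n) + 20) S ∧
      memory n Wbar (k + 1) ⊆ S := by
  set M := memory n Wbar k with hM
  have hcur : ∀ f ∈ stateValues n Wbar k, f ∈ M := fun f hf => Or.inr ⟨k, le_rfl, hf⟩
  have hw : ∀ l, (fun d : InputOn n Wbar => d.1.w l) ∈ M :=
    fun l => Or.inl (Or.inl (Or.inr (Or.inl ⟨l, rfl⟩)))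
  have hC : ∀ l i j, (fun d : InputOn n Wbar => d.1.C l i j) ∈ M :=
    fun l i j => Or.inl (Or.inl (Or.inr (Or.inr (Or.inl ⟨l, i, j, rfl⟩))))
  have hW : ∀ l j, (fun d : InputOn n Wbar => d.1.Wbar l j) ∈ M :=
    fun l j => Or.inl (Or.inl (Or.inr (Or.inr (Or.inr (Or.inl ⟨l, j, rfl⟩)))))
  have hL : (fun d : InputOn n Wbar => d.1.L) ∈ M :=
    Or.inl (Or.inl (Or.inr (Or.inr (Or.inr (Or.inr (Or.inr rfl))))))
  have hp : ∀ l i, (fun d : InputOn n Wbar => d.1.smoothed.p l i) ∈ M :=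
    fun l i => Or.inl (Or.inr (Or.inl ⟨l, i, rfl⟩))
  have hγ : ∀ l, (fun d : InputOn n Wbar => gam n d.1.ε d.1.w l) ∈ M :=
    fun l => Or.inl (Or.inr (Or.inr ⟨l, rfl⟩))
  have hA : (fun d : InputOn n Wbar => (run d.1.smoothed k).A) ∈ M := hcur _ (Or.inl rfl)
  have hζ : ∀ l i, (fun d : InputOn n Wbar => (run d.1.smoothed k).zeta l i) ∈ M :=
    fun l i => hcur _ (Or.inr ⟨l, i, Or.inr (Or.inl rfl)⟩)
  have hη : ∀ l i, (fun d : InputOn n Wbar => (run d.1.smoothed k).eta l i) ∈ M :=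
    fun l i => hcur _ (Or.inr ⟨l, i, Or.inr (Or.inr (Or.inl rfl))⟩)
  have hq : ∀ l i, (fun d : InputOn n Wbar => (run d.1.smoothed k).q l i) ∈ M :=
    fun l i => hcur _ (Or.inr ⟨l, i, Or.inr (Or.inr (Or.inr rfl))⟩)
  set A : InputOn n Wbar → ℝ := fun d => (run d.1.smoothed k).A
  set α : InputOn n Wbar → ℝ := fun d => stepSize d.1.L (A d) with hα
  set A' : InputOn n Wbar → ℝ := fun d => A d + α d with hA'
  set x : Fin m → Fin n → InputOn n Wbar → ℝ := fun l i d =>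
    (α d * (run d.1.smoothed k).zeta l i + A d * (run d.1.smoothed k).eta l i) / A' d with hx
  set E : Fin m → Fin n → Fin n → InputOn n Wbar → ℝ := fun l j i d =>
    Real.exp ((x l i d - d.1.C l j i) / gam n d.1.ε d.1.w l) with hE
  set Z : Fin m → Fin n → InputOn n Wbar → ℝ := fun l j d => ∑ r, E l j r d with hZ
  set g : Fin m → Fin n → InputOn n Wbar → ℝ := fun l i d =>
    ∑ j, d.1.smoothed.p l j * (E l j i d / Z l j d) with hg
  set G : Fin m → Fin n → InputOn n Wbar → ℝ := fun l i d =>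
    ∑ j with Wbar l j ≠ 0, d.1.Wbar l j * g j i d with hG
  set ζ : Fin m → Fin n → InputOn n Wbar → ℝ := fun l i d =>
    (run d.1.smoothed k).zeta l i - α d / d.1.w l * G l i d with hζ'
  obtain ⟨S1, r1, h1⟩ : Comp M 11 α :=
    ((Comp.one M).add ((Comp.one M).add (((Comp.ofNat M 8).mul (Comp.of_mem hL)).mul
      (Comp.of_mem hA))).sqrt).div ((Comp.ofNat M 4).mul (Comp.of_mem hL))
  obtain ⟨S2, r2, h2⟩ : Comp S1 1 A' := (Comp.of_mem (r1.subset hA)).add (Comp.of_mem h1)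
  have s2 := r1.trans r2
  have hα2 := r2.subset h1
  obtain ⟨S3, r3, h3⟩ := exists_reach_grid (S := S2) (k := 4) (F := x) fun l i =>
    (((Comp.of_mem hα2).mul (Comp.of_mem (s2.subset (hζ l i)))).add
      ((Comp.of_mem (s2.subset hA)).mul (Comp.of_mem (s2.subset (hη l i))))).div (Comp.of_mem h2)
  have s3 := s2.trans r3
  obtain ⟨S4, r4, h4⟩ := exists_reach (S := S3) (c := fun _ => 3)
    (F := fun y : Fin m × Fin n × Fin n => E y.1 y.2.1 y.2.2) fun y =>
    (((Comp.of_mem (h3 y.1 y.2.2)).sub (Comp.of_mem (s3.subset (hC y.1 y.2.1 y.2.2)))).div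
      (Comp.of_mem (s3.subset (hγ y.1)))).exp
  have s4 := s3.trans r4
  obtain ⟨S5, r5, h5⟩ := exists_reach_grid (S := S4) (F := Z) fun l j =>
    Comp.sum Finset.univ fun i => Comp.of_mem (h4 (l, j, i))
  have s5 := s4.trans r5
  obtain ⟨S6, r6, h6⟩ := exists_reach_grid (S := S5) (F := g) fun l i =>
    Comp.sum Finset.univ fun j => (Comp.of_mem (s5.subset (hp l j))).mul
      ((Comp.of_mem (r5.subset (h4 (l, j, i)))).div (Comp.of_mem (h5 l j)))
  have s6 := s5.trans r6
  obtain ⟨S7, r7, h7⟩ := exists_reach (S := S6) (F := fun y : Fin m × Fin n => G y.1 y.2) fun y =>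
    Comp.sum (Finset.univ.filter fun j => Wbar y.1 j ≠ 0) fun j =>
      (Comp.of_mem (s6.subset (hW y.1 j))).mul (Comp.of_mem (h6 j y.2))
  have s7 := s6.trans r7
  have r27 := ((((r3.trans r4).trans r5).trans r6).trans r7)
  obtain ⟨S8, r8, h8⟩ := exists_reach_grid (S := S7) (F := ζ) fun l i =>
    (Comp.of_mem (s7.subset (hζ l i))).sub (((Comp.of_mem (r27.subset hα2)).div
      (Comp.of_mem (s7.subset (hw l)))).mul (Comp.of_mem (h7 (l, i))))
  have s8 := s7.trans r8
  have r28 := r27.trans r8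
  obtain ⟨S9, r9, h9⟩ := exists_reach_grid (S := S8)
    (F := fun l i d => (α d * ζ l i d + A d * (run d.1.smoothed k).eta l i) / A' d) fun l i =>
    (((Comp.of_mem (r28.subset hα2)).mul (Comp.of_mem (h8 l i))).add
      ((Comp.of_mem (s8.subset hA)).mul (Comp.of_mem (s8.subset (hη l i))))).div
        (Comp.of_mem (r28.subset h2))
  have s9 := s8.trans r9
  have r29 := r28.trans r9
  have r69 := (r7.trans r8).trans r9
  obtain ⟨S10, r10, h10⟩ := exists_reach_grid (S := S9)
    (F := fun l i d => (α d * g l i d + A d * (run d.1.smoothed k).q l i) / A' d) fun l i =>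
    (((Comp.of_mem (r29.subset hα2)).mul (Comp.of_mem (r69.subset (h6 l i)))).add
      ((Comp.of_mem (s9.subset hA)).mul (Comp.of_mem (s9.subset (hq l i))))).div
        (Comp.of_mem (r29.subset h2))
  refine ⟨S10, (s9.trans r10).le ?_, ?_⟩
  · have hs := sum_card_support (n := n) (Wbar := Wbar)
    simp only [Finset.sum_add_distrib, ← Finset.sum_mul, hs]
    simp
    have h0 := Nat.zero_le (m * n)
    linarith
  -- The program sums only over the pattern of `Wbar`; the remaining entries of `d.Wbar` vanish by
  -- the definition of `InputOn`.
  have hGeq : ∀ (l : Fin m) (i : Fin n) (d : InputOn n Wbar),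
      ∑ j, d.1.Wbar l j * g j i d = G l i d := by
    intro l i d
    refine (Finset.sum_filter_of_ne (p := fun j => Wbar l j ≠ 0) fun j _ hj h0 => hj ?_).symm
    rw [d.2 l j h0, zero_mul]
  have hζeq : ∀ l i, (fun d : InputOn n Wbar => (run d.1.smoothed (k + 1)).zeta l i) = ζ l i := by
    intro l i
    funext d
    rw [hζ']
    simp only [← hGeq]
    rfl
  have hηeq : ∀ l i, (fun d : InputOn n Wbar => (run d.1.smoothed (k + 1)).eta l i) =
      fun d => (α d * ζ l i d + A d * (run d.1.smoothed k).eta l i) / A' d := by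
    intro l i
    funext d
    rw [← hζeq]
    rfl
  rintro f (hf | ⟨j, hj, hf⟩)
  · exact r10.subset (s9.subset (Or.inl hf))
  · rcases Nat.le_succ_iff.1 hj with hj | rfl
    · exact r10.subset (s9.subset (Or.inr ⟨j, hj, hf⟩))
    · rcases hf with rfl | ⟨l, i, rfl | rfl | rfl | rfl⟩
      · exact r10.subset (r29.subset h2)
      · exact r10.subset ((((((r4.trans r5).trans r6).trans r7).trans r8).trans r9).subset (h3 l i))
      · rw [hζeq]
        exact r10.subset (r9.subset (h8 l i))
      · rw [hηeq]
        exact r10.subset (h9 l i)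
      · exact h10 l i

theorem exists_program (hm : 1 ≤ m) (hn : 1 ≤ n) {N : ℕ} (hN : 1 ≤ N) :
    ∃ (k : ℕ) (S : Set (InputOn n Wbar → ℝ)), k ≤ 100 * (N * (n * (m * n + nnz Wbar))) ∧
      Program (inputValues n Wbar) k S ∧ iterateValues n Wbar N ⊆ S := by
  set c := m * n * n * 3 + m * n * (n * 4) + 2 * (n * nnz Wbar) + 22 * (m * n) + 20 with hc
  set b := 11 * (m * n) + 8 * m + 1 with hb
  have key : ∀ k, ∃ S, Reach (inputValues n Wbar) (b + k * c) S ∧ memory n Wbar k ⊆ S := by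
    intro k
    induction k with
    | zero => simpa using exists_reach_memory_zero
    | succ k ih =>
      obtain ⟨S, ⟨i, hi, hS⟩, hMS⟩ := ih
      obtain ⟨T, ⟨j, hj, hT⟩, hMT⟩ := exists_reach_memory_succ (n := n) (Wbar := Wbar) k
      have hT' := hT.union S
      rw [Set.union_eq_self_of_subset_left hMS] at hT'
      refine ⟨T ∪ S, ⟨i + j, ?_, hS.trans hT'⟩, hMT.trans Set.subset_union_left⟩
      linarith
  obtain ⟨S, ⟨k, hk, hS⟩, hMS⟩ := key N
  refine ⟨k, S, hk.trans ?_, hS, fun f hf => hMS ?_⟩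
  -- Each monomial is at most `n (m n + nnz)`, so the constants are sums of coefficients: `7 + 22 +
  -- 20 = 49` per iteration and `11 + 8 + 1 = 20` at the start, together below `100`.
  · have h0 : 0 ≤ n * nnz Wbar := Nat.zero_le _
    have h1 : m * n ≤ n * (m * n) := Nat.le_mul_of_pos_left _ hn
    have h2 : m ≤ m * n := Nat.le_mul_of_pos_right _ hn
    have hc' : c ≤ 49 * (n * (m * n + nnz Wbar)) := by
      rw [hc]
      linarith
    have hb' : b ≤ 20 * (n * (m * n + nnz Wbar)) := by
      rw [hb]
      linarith
    have h3 : n * (m * n + nnz Wbar) ≤ N * (n * (m * n + nnz Wbar)) :=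
      Nat.le_mul_of_pos_left _ hN
    have h4 := Nat.mul_le_mul_left N hc'
    linarith
  · obtain ⟨j, _, hj, hf⟩ := hf
    exact Or.inr ⟨j, hj, hf⟩

end OperationCount

end WassersteinBarycenter

end

theorem theorem3 :
    ∃ K : ℕ, ∀ (m n : ℕ), 2 ≤ m → 2 ≤ n →
    ∀ Wbar : Matrix (Fin m) (Fin m) ℝ, Wbar.PosSemidef →
    LinearMap.ker Wbar.mulVecLin = Submodule.span ℝ {fun _ => (1 : ℝ)} →
    ∀ N : ℕ, 1 ≤ N →
    -- accuracy
    (∀ (ε : ℝ) (w : Fin m → ℝ) (C : Fin m → Matrix (Fin n) (Fin n) ℝ) (p p' : Fin m → Fin n → ℝ),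
      0 < ε → (∀ l, 0 < w l) → ∑ l, w l = 1 → (∀ l i j, 0 ≤ C l i j) →
      (∀ l, p l ∈ stdSimplex ℝ (Fin n)) →
      (∀ l, WassersteinBarycenter.Admissible ε (p l) (p' l)) →
      WassersteinBarycenter.iterBound 64 ε w C Wbar ≤ N →
      let q : Fin m → Fin n → ℝ := (WassersteinBarycenter.run
        ⟨p', w, C, Wbar, ε, WassersteinBarycenter.lipConst n ε Wbar⟩ N).q
      (∀ l, q l ∈ stdSimplex ℝ (Fin n)) ∧
      -- suboptimality with respect to every point of the simplex, in particular every barycenter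
      (∀ q' ∈ stdSimplex ℝ (Fin n),
        ∑ l, w l * WassersteinBarycenter.otCost (C l) (p' l) (q l) -
          ∑ l, w l * WassersteinBarycenter.otCost (C l) (p' l) q' ≤ ε) ∧
      (∀ q' ∈ stdSimplex ℝ (Fin n),
        ∑ l, w l * WassersteinBarycenter.otCost (C l) (p l) (q l) -
          ∑ l, w l * WassersteinBarycenter.otCost (C l) (p l) q' ≤
            ε / 2 + ε / 4 * ∑ l, w l * WassersteinBarycenter.maxEntry (C l)) ∧
      -- the bound on a dual solution, and the consensus bound
      (∃ u : Fin m × Fin n → ℝ,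
        IsMinOn (WassersteinBarycenter.dualObjective ε w C Wbar p') Set.univ u ∧
        WassersteinBarycenter.norm2 u ≤ WassersteinBarycenter.dualRadius 1 w C Wbar) ∧
      WassersteinBarycenter.norm2 ((WassersteinBarycenter.sqrtW n Wbar).mulVec
          (WassersteinBarycenter.stack q)) ≤
        ε / (2 * WassersteinBarycenter.dualRadius 1 w C Wbar) ∧
      (WassersteinBarycenter.iterBound 256 ε w C Wbar ≤ N →
        WassersteinBarycenter.norm2 ((WassersteinBarycenter.sqrtW n Wbar).mulVec
            (WassersteinBarycenter.stack q)) ≤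
          ε / (2 * WassersteinBarycenter.dualRadius 2 w C Wbar))) ∧
    -- arithmetic operations
    ∃ (k : ℕ) (S : Set (WassersteinBarycenter.InputOn n Wbar → ℝ)),
      k ≤ K * (N * (n * (m * n + WassersteinBarycenter.nnz Wbar))) ∧
      WassersteinBarycenter.Program (WassersteinBarycenter.inputValues n Wbar) k S ∧
      WassersteinBarycenter.iterateValues n Wbar N ⊆ S := by
  refine ⟨100, fun m n hm hn Wbar hW hker N hN =>
    ⟨fun ε w C p p' hε hw hw1 hC hp hadm hb => ?_,
      WassersteinBarycenter.exists_program (by omega) (by omega) hN⟩⟩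
  have hn0 : n ≠ 0 := by omega
  have hL : 0 < WassersteinBarycenter.lipConst n ε Wbar := by
    have h1 := WassersteinBarycenter.lamMax_pos
      (WassersteinBarycenter.posSemidef_bigW (n := n) hW)
      (WassersteinBarycenter.bigW_ne_zero hn0 (WassersteinBarycenter.ne_zero_of_ker hm hker))
    have h2 : 0 < Real.log n := Real.log_pos (by exact_mod_cast hn)
    have h3 : (0 : ℝ) < m := by positivity
    unfold WassersteinBarycenter.lipConst
    positivity
  have hd : WassersteinBarycenter.Input.Valid
      ⟨p', w, C, Wbar, ε, WassersteinBarycenter.lipConst n ε Wbar⟩ :=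
    ⟨by omega, hn, hε, hw, fun l => (hadm l).1, hW, rfl, hL⟩
  refine ⟨fun l => hd.run_q_mem hN l, fun q' hq' => ?_,
    fun q' hq' => hd.gap_le_of_admissible hw1 hC hker hN hp hadm hq',
    hd.exists_isMinOn_dualObjective hm hC hker,
    hd.norm2_consensus_le hm hC hker hN le_rfl (by norm_num) hb,
    fun hb' => hd.norm2_consensus_le hm hC hker hN one_le_two (by norm_num) hb'⟩
  exact (hd.gap_le hw1 hC hker hN hq').trans (half_le_self hε.le)
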